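/- All graphs are finite, simple and connected. For a connected graph $G$, a tree $t$-spanner is a spanning tree $T$ of $G$ such that any two vertices adjacent in $G$ are at distance at most $t$ in $T$; the stretch index $\sigma(G)$ is the smallest $t$ for which $G$ admits a tree $t$-spanner. A graph is split if its vertex set can be partitioned into a clique and an independent set. The total chromatic number $\chi''(G)$ is the least number of colors in a coloring of the vertices and edges of $G$ in which adjacent or incident elements receive distinct colors, and $G$ is Type 2 if $\chi''(G)=\Delta(G)+2$, where $\Delta(G)$ is the maximum degree. Theorem. Let $G$ be a split graph with $\sigma(G)=2$ and with $\Delta(G)$ odd, let $P$ be the set of vertices of degree $1$ in $G$, and let $H=G[V(G)\setminus P]$. Then $G$ is Type 2 if and only if $\Delta(H)=\Delta(G)$ and $$|E(\overline{H})|+\alpha'(\overline{H})<\frac{|V(H)|}{2},$$ where $\overline{H}$ is the complement of $H$ and $\alpha'(\overline{H})$ is the maximum number of edges in a matching of $\overline{H}$. -/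

import Mathlib

namespace SimpleGraph

/-- A split graph: the vertex set is partitioned into a clique `X` and an independent set `Y`
(one of which may be empty). -/
def IsSplit {V : Type*} (G : SimpleGraph V) : Prop :=
  ∃ X Y : Set V, IsCompl X Y ∧ G.IsClique X ∧ G.IsIndepSet Y

/-- `T` is a tree `t`-spanner of `G`: a spanning tree of `G` in which any two vertices adjacent
in `G` are at distance at most `t`. -/
def IsTreeSpanner {V : Type*} (G T : SimpleGraph V) (t : ℕ) : Prop :=
  T ≤ G ∧ T.IsTree ∧ ∀ ⦃u v : V⦄, G.Adj u v → T.dist u v ≤ t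

/-- The stretch index `σ(G)` of a connected graph: the smallest `t` such that `G` admits a tree
`t`-spanner. -/
noncomputable def stretchIndex {V : Type*} (G : SimpleGraph V) : ℕ :=
  sInf {t : ℕ | ∃ T : SimpleGraph V, G.IsTreeSpanner T t}

/-- A (proper) total coloring of `G` with colors in `C`: vertices and edges are colored so that
adjacent or incident elements receive distinct colors. -/
structure TotalColoring {V : Type*} (G : SimpleGraph V) (C : Type*) where
  /-- the colors of the vertices -/
  vertColor : V → C
  /-- the colors of the edges -/
  edgeColor : G.edgeSet → C
  vert_ne_vert : ∀ ⦃u v : V⦄, G.Adj u v → vertColor u ≠ vertColor v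
  edge_ne_edge : ∀ ⦃e f : G.edgeSet⦄, e ≠ f →
    (∃ v : V, v ∈ (e : Sym2 V) ∧ v ∈ (f : Sym2 V)) → edgeColor e ≠ edgeColor f
  vert_ne_edge : ∀ ⦃v : V⦄ ⦃e : G.edgeSet⦄, v ∈ (e : Sym2 V) → vertColor v ≠ edgeColor e

/-- The total chromatic number `χ''(G)` of a finite graph. -/
noncomputable def totalChromaticNumber {V : Type*} (G : SimpleGraph V) : ℕ :=
  sInf {n : ℕ | Nonempty (G.TotalColoring (Fin n))}

/-- `G` is Type 2: its total chromatic number is `Δ(G) + 2`. -/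
def IsType2 {V : Type*} [Fintype V] (G : SimpleGraph V) [DecidableRel G.Adj] : Prop :=
  G.totalChromaticNumber = G.maxDegree + 2

/-- The matching number `α'(G)` of a finite graph: the largest number of edges of a matching. -/
noncomputable def matchingNumber {V : Type*} (G : SimpleGraph V) : ℕ :=
  sSup {n : ℕ | ∃ M : G.Subgraph, M.IsMatching ∧ M.edgeSet.ncard = n}

/-- Hilton's condition `|E(Gᶜ)| + α'(Gᶜ) < |V(G)| / 2` for a finite graph. -/
def HiltonCondition {V : Type*} (G : SimpleGraph V) : Prop :=
  (Gᶜ.edgeSet.ncard : ℚ) + (Gᶜ.matchingNumber : ℚ) < (Nat.card V : ℚ) / 2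

/-- The set of pendant vertices (vertices of degree one). -/
abbrev pendantVerts {V : Type*} [Fintype V] (G : SimpleGraph V) [DecidableRel G.Adj] : Set V :=
  {v : V | G.degree v = 1}

/-- The graph obtained from `G` by deleting its pendant vertices. -/
abbrev deletePendants {V : Type*} [Fintype V] (G : SimpleGraph V) [DecidableRel G.Adj] :
    SimpleGraph ↥(G.pendantVertsᶜ : Set V) :=
  G.induce (G.pendantVertsᶜ : Set V)

end SimpleGraph

/-! In a split graph with $\sigma=2$, a tree 2-spanner maps the clique side into a closed star, and
its centre is adjacent to every other non-pendant vertex (`exists_center_of_stretchIndex_eq_two`).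
Hence $|V(H)|=\Delta(H)+1$. Pendant vertices never obstruct: a total colouring of $H$ with at least
$\Delta(G)+1$ colours extends greedily to $G$. So everything is decided by how many colours $H$
needs.

If $\Delta(H)<\Delta(G)$, then $|V(H)|$ is at most the odd number $\Delta(G)$, and $u+v$ in
$\mathbb{Z}/\Delta(G)$ colours $H$ cheaply. Otherwise $|V(H)|=\Delta(G)+1=2m$ is even, and the
question is whether $H$ has a total colouring with $2m$ colours, which is Hilton's criterion.

Necessity (`IsRowColoring.card_le_of_even`) is a parity count of the colours missing at vertices.
Sufficiency (`exists_row_coloring_compl`) builds a $2m\times 2m$ array with diagonal entries as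
vertex colours. The array may be asymmetric only on a few edges $E$ of $\overline{H}$, and diagonal
entries may coincide only on a matching $M\subseteq E$ with $|E|+|M|=m$. These edges fit into $m$
vertices; that block is filled greedily and then enlarged one vertex at a time by an embedding
argument in the style of Ryser, resting on Hall's theorem and a parity condition on symbols. -/

/-! ### Saturating matchings from Hall's theorem -/

open Finset in
/-- In a bipartite graph whose left vertices have degree `k` and whose right vertices have degree
at most `k`, some matching saturates all left vertices and all right vertices of degree `k`. -/
theorem exists_injective_saturating {α β : Type*} [Fintype α] [Fintype β]
    (R : α → β → Prop) [∀ a, DecidablePred (R a)] [∀ b, DecidablePred (fun a => R a b)]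
    {k : ℕ} (hk : 0 < k) (hα : ∀ a, #{b | R a b} = k) (hβ : ∀ b, #{a | R a b} ≤ k) :
    ∃ g : α → β, Function.Injective g ∧ (∀ a, R a (g a)) ∧
      ∀ b, #{a | R a b} = k → b ∈ Set.range g := by
  classical
  have hdc : ∑ b, #{a | R a b} = k * Fintype.card α := by
    have h := Finset.sum_card_bipartiteAbove_eq_sum_card_bipartiteBelow (s := (univ : Finset α))
      (t := (univ : Finset β)) R
    simp only [bipartiteAbove, bipartiteBelow] at h
    rw [← h, sum_congr rfl fun a _ => hα a]
    simp [mul_comm]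
  have hle : Fintype.card α ≤ Fintype.card β := by
    have h : ∑ b, #{a | R a b} ≤ ∑ _b : β, k := sum_le_sum fun b _ => hβ b
    rw [hdc] at h
    simp only [sum_const, smul_eq_mul, card_univ] at h
    exact Nat.le_of_mul_le_mul_left (by linarith) hk
  obtain ⟨p, hp⟩ := Nat.exists_eq_add_of_le hle
  -- Pad the left side with `p` dummies joined to the right vertices of degree below `k`. The
  -- missing degree is shared equally among the dummies, so `w` has row sums `k` and column sums at
  -- most `k`, which is a fractional form of Hall's condition.
  let t : α ⊕ Fin p → Finset β := 
    Sum.elim (fun a => univ.filter (R a)) (fun _ => univ.filter fun b => #{a | R a b} < k)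
  let w : α ⊕ Fin p → β → ℚ :=
    Sum.elim (fun a b => if R a b then 1 else 0) (fun _ b => ((k : ℚ) - #{a | R a b}) / p)
  have hw0 : ∀ i b, 0 ≤ w i b := by
    rintro (a | x) b
    · simp only [w, Sum.elim_inl]; split_ifs <;> norm_num
    · simp only [w, Sum.elim_inr]
      have : (#{a | R a b} : ℚ) ≤ k := by exact_mod_cast hβ b
      exact div_nonneg (by linarith) (by positivity)
  have hwt : ∀ i, ∑ b ∈ t i, w i b = k := by
    rintro (a | x)
    · simp only [w, t, Sum.elim_inl]
      rw [sum_congr rfl (g := fun _ => (1 : ℚ)) (by intro b hb; simp at hb; simp [hb])]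
      simp [hα a]
    · have hp0 : (p : ℚ) ≠ 0 := by
        have := x.pos
        positivity
      have h1 : ∑ b ∈ t (.inr x), w (.inr x) b = ∑ b, w (.inr x) b := by
        refine sum_subset (subset_univ _) fun b _ hb => ?_
        simp only [t, Sum.elim_inr, mem_filter, mem_univ, true_and, not_lt] at hb
        have : #{a | R a b} = k := le_antisymm (hβ b) hb
        simp [w, this]
      rw [h1]
      simp only [w, Sum.elim_inr]
      rw [← sum_div, sum_sub_distrib]
      have h2 : (∑ b, (#{a | R a b} : ℚ)) = k * Fintype.card α := by exact_mod_cast hdc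
      rw [h2]
      simp only [sum_const, card_univ, nsmul_eq_mul, hp]
      field_simp
      push_cast
      ring
  have hcol : ∀ b, ∑ i, w i b ≤ k := by
    intro b
    rw [Fintype.sum_sum_type]
    simp only [w, Sum.elim_inl, Sum.elim_inr, sum_boole, sum_const, card_univ, Fintype.card_fin,
      nsmul_eq_mul]
    have h1 : (#{a | R a b} : ℚ) ≤ k := by exact_mod_cast hβ b
    rcases Nat.eq_zero_or_pos p with h0 | h0
    · subst h0; simpa using h1
    · have : (p : ℚ) ≠ 0 := by positivity
      rw [mul_div_cancel₀ _ this]; linarith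
  have hall : ∀ s : Finset (α ⊕ Fin p), #s ≤ #(s.biUnion t) := by
    intro s
    have hkq : (0 : ℚ) < k := by exact_mod_cast hk
    have h : (k : ℚ) * #s ≤ k * #(s.biUnion t) := by
      calc (k : ℚ) * #s = ∑ i ∈ s, ∑ b ∈ t i, w i b := by
            rw [sum_congr rfl fun i _ => hwt i]; simp [mul_comm]
        _ ≤ ∑ i ∈ s, ∑ b ∈ s.biUnion t, w i b := by
            refine sum_le_sum fun i hi => sum_le_sum_of_subset_of_nonneg
              (subset_biUnion_of_mem t hi) fun b _ _ => hw0 i b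
        _ = ∑ b ∈ s.biUnion t, ∑ i ∈ s, w i b := sum_comm
        _ ≤ ∑ b ∈ s.biUnion t, (k : ℚ) := by
            refine sum_le_sum fun b _ => le_trans ?_ (hcol b)
            exact sum_le_sum_of_subset_of_nonneg (subset_univ _) fun i _ _ => hw0 i b
        _ = k * #(s.biUnion t) := by simp [mul_comm]
    exact_mod_cast le_of_mul_le_mul_left h hkq
  obtain ⟨f, hf, hft⟩ := (Finset.all_card_le_biUnion_card_iff_exists_injective t).1 hall
  have hbij : Function.Bijective f :=
    (Fintype.bijective_iff_injective_and_card f).2 ⟨hf, by simp [hp]⟩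
  refine ⟨fun a => f (.inl a), hf.comp Sum.inl_injective, fun a => by simpa [t] using hft (.inl a),
    fun b hb => ?_⟩
  -- The padded matching is a bijection, and a dummy is never joined to a vertex of full degree `k`.
  obtain ⟨i | x, rfl⟩ := hbij.2 b
  · exact ⟨i, rfl⟩
  · have := hft (.inr x)
    simp only [t, Sum.elim_inr, mem_filter, mem_univ, true_and] at this
    omega

open Finset in
theorem exists_injOn_saturating {α β : Type*} [Fintype β] [Nonempty β] (T : Finset α)
    (R : α → β → Prop) [∀ a, DecidablePred (R a)] [∀ b, DecidablePred (fun a => R a b)]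
    {k : ℕ} (hk : 0 < k) (hα : ∀ a ∈ T, #{b | R a b} = k) (hβ : ∀ b, #{a ∈ T | R a b} ≤ k) :
    ∃ g : α → β, Set.InjOn g T ∧ (∀ a ∈ T, R a (g a)) ∧
      ∀ b, #{a ∈ T | R a b} = k → ∃ a ∈ T, g a = b := by
  classical
  have hc : ∀ b, #{a : T | R a b} = #{a ∈ T | R a b} := fun b => by
    rw [← card_map (Function.Embedding.subtype (· ∈ T))]
    congr 1
    ext a
    simp [and_comm]
  obtain ⟨g, hg, hR, hs⟩ := exists_injective_saturating (fun (a : T) b => R a b) hk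
    (fun a => hα a a.2) (fun b => by rw [hc]; exact hβ b)
  refine ⟨Function.extend Subtype.val g fun _ => Classical.arbitrary β, ?_, ?_, ?_⟩
  · intro a ha b hb h
    have h1 := Subtype.val_injective.extend_apply g (fun _ => Classical.arbitrary β) ⟨a, ha⟩
    have h2 := Subtype.val_injective.extend_apply g (fun _ => Classical.arbitrary β) ⟨b, hb⟩
    simp only at h1 h2
    rw [h1, h2] at h
    exact congrArg Subtype.val (hg h)
  · intro a ha
    have h1 := Subtype.val_injective.extend_apply g (fun _ => Classical.arbitrary β) ⟨a, ha⟩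
    simp only at h1
    rw [h1]
    exact hR ⟨a, ha⟩
  · intro b hb
    obtain ⟨a, rfl⟩ := hs b (by rw [hc]; exact hb)
    exact ⟨a, a.2, Subtype.val_injective.extend_apply g _ a⟩

/-! ### Enlarging an array one vertex at a time -/

open Finset in
/-- The number of rows of the block of `L` indexed by `S` in which the symbol `c` occurs. -/
def rowCount {V C : Type*} [DecidableEq C] (S : Finset V) (L : V → V → C) (c : C) : ℕ :=
  #{u ∈ S | ∃ v ∈ S, L u v = c}

-- The inductive step of the embedding. The new column, copied as the new row, comes from a matching
-- of rows with symbols: a row of `S` may take any symbol it lacks, and the new diagonal cell any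
-- symbol of `F`. Both kinds have exactly `k + 1` choices, and the counting hypothesis bounds the
-- demand for each symbol by `k + 1`. Saturating the tight symbols preserves the count, and the
-- parity condition handles the unused ones.
open Finset in
theorem exists_extend_one {V C : Type*} [Fintype C] [DecidableEq V] [DecidableEq C]
    {S : Finset V} {b : V} (hb : b ∉ S) {k : ℕ} (hn : Fintype.card C = #S + (k + 1))
    {F : Finset C} (hF : #F = k + 1) {L : V → V → C} (hrow : ∀ u ∈ S, Set.InjOn (L u) S)
    (hN : ∀ c, #S + (if c ∈ F then 1 else 0) ≤ rowCount S L c + (k + 1))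
    (hpar : ∀ c, Even (rowCount S L c + (if c ∈ F then 1 else 0) + Fintype.card C)) :
    ∃ L' : V → V → C, ∃ d ∈ F, (∀ u ∈ S, ∀ v ∈ S, L' u v = L u v) ∧
      (∀ u ∈ insert b S, L' u b = L' b u) ∧ L' b b = d ∧
      (∀ u ∈ insert b S, Set.InjOn (L' u) (insert b S : Finset V)) ∧
      (∀ c, #(insert b S) + (if c ∈ F.erase d then 1 else 0) ≤ rowCount (insert b S) L' c + k) ∧
      (∀ c, Even (rowCount (insert b S) L' c + (if c ∈ F.erase d then 1 else 0) +
        Fintype.card C)) := by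
  have : Nonempty C := Fintype.card_pos_iff.1 (by omega)
  let R : V → C → Prop := fun v c => (v = b ∧ c ∈ F) ∨ (v ∈ S ∧ ∀ w ∈ S, L v w ≠ c)
  have hdeg : ∀ c, #{a ∈ insert b S | R a c} + rowCount S L c =
      #S + (if c ∈ F then 1 else 0) := by
    intro c
    have h1 : #{a ∈ S | R a c} + rowCount S L c = #S := by
      rw [rowCount, add_comm, ← card_filter_add_card_filter_not (s := S) (fun u => ∃ v ∈ S, L u v = c)]
      congr 2
      refine filter_congr fun a ha => ?_
      have : a ≠ b := fun h => hb (h ▸ ha)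
      simp [R, ha, this]
    rw [filter_insert]
    have h2 : R b c ↔ c ∈ F := by simp [R, hb]
    by_cases hc : c ∈ F
    · rw [if_pos (h2.2 hc), card_insert_of_notMem (by simp [hb])]
      simp [hc]; omega
    · rw [if_neg (fun h => hc (h2.1 h))]
      simp [hc]; omega
  obtain ⟨g, hg, hgR, hgs⟩ := exists_injOn_saturating (insert b S) R (Nat.succ_pos k)
    (by
      intro a ha
      rcases mem_insert.1 ha with rfl | ha
      · rw [Nat.succ_eq_add_one, ← hF]
        congr 1; ext c; simp [R, hb]
      · have hab : a ≠ b := fun h => hb (h ▸ ha)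
        have h1 : (univ.filter fun c => R a c) = (S.image (L a))ᶜ := by
          ext c; simp [R, ha, hab]
        rw [h1, card_compl, card_image_of_injOn (hrow a ha)]
        omega)
    (by intro c; have := hdeg c; have := hN c; omega)
  have hgS : ∀ a ∈ S, ∀ w ∈ S, L a w ≠ g a := fun a ha => by
    have hab : a ≠ b := fun h => hb (h ▸ ha)
    have := hgR a (mem_insert_of_mem ha)
    simp only [R, hab, false_and, false_or] at this
    exact this.2
  have hgb : g b ∈ F := by simpa [R, hb] using hgR b (mem_insert_self b S)
  have hgne : ∀ a ∈ S, g a ≠ g b := fun a ha h =>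
    hb (hg (mem_insert_of_mem ha) (mem_insert_self b S) h ▸ ha)
  let L' : V → V → C := fun u v => if u = b then g v else if v = b then g u else L u v
  have hLS : ∀ u ∈ S, ∀ v ∈ S, L' u v = L u v := fun u hu v hv => by
    have h1 : u ≠ b := fun h => hb (h ▸ hu)
    have h2 : v ≠ b := fun h => hb (h ▸ hv)
    simp [L', h1, h2]
  have hLb : ∀ u, L' u b = g u := fun u => by
    by_cases h : u = b <;> simp [L', h]
  have hbL : ∀ u, L' b u = g u := fun u => by simp [L']
  have hcount : ∀ c, rowCount (insert b S) L' c =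
      rowCount S L c + 2 * (if ∃ a ∈ S, g a = c then 1 else 0) + if g b = c then 1 else 0 := by
    intro c
    have h1 : #{u ∈ S | ∃ v ∈ insert b S, L' u v = c} =
        rowCount S L c + if ∃ a ∈ S, g a = c then 1 else 0 := by
      have h2 : #{u ∈ S | g u = c} = if ∃ a ∈ S, g a = c then 1 else 0 := by
        split_ifs with h
        · obtain ⟨a, ha, rfl⟩ := h
          rw [card_eq_one]
          refine ⟨a, ?_⟩
          ext u
          simp only [mem_filter, mem_singleton]
          refine ⟨fun h => hg (mem_insert_of_mem h.1) (mem_insert_of_mem ha) h.2, ?_⟩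
          rintro rfl; exact ⟨ha, rfl⟩
        · rw [card_eq_zero, filter_eq_empty_iff]
          push Not at h
          exact fun u hu => h u hu
      rw [← h2, rowCount, ← card_union_of_disjoint]
      · rw [← filter_or]
        congr 1
        refine filter_congr fun u hu => ?_
        simp only [mem_insert, exists_eq_or_imp, hLb]
        rw [or_comm]
        refine or_congr (exists_congr fun v => and_congr_right fun hv => ?_) Iff.rfl
        rw [hLS u hu v hv]
      · rw [disjoint_filter]
        rintro u hu ⟨v, hv, rfl⟩ h
        exact hgS u hu v hv h.symm
    rw [rowCount, filter_insert]
    have h3 : (∃ v ∈ insert b S, L' b v = c) ↔ g b = c ∨ ∃ a ∈ S, g a = c := by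
      simp [hbL]
    by_cases hc : g b = c
    · have h4 : ¬ ∃ a ∈ S, g a = c := by
        rintro ⟨a, ha, h⟩
        exact hgne a ha (h.trans hc.symm)
      rw [if_pos (h3.2 (Or.inl hc)), card_insert_of_notMem (by simp [hb]), h1]
      simp [hc, h4]
    · by_cases h4 : ∃ a ∈ S, g a = c
      · rw [if_pos (h3.2 (Or.inr h4)), card_insert_of_notMem (by simp [hb]), h1]
        simp [hc, h4]
      · rw [if_neg (fun h => (h3.1 h).elim hc h4), h1]
        simp [hc, h4]
  have hrange : ∀ c, #{a ∈ insert b S | R a c} = k + 1 → g b ≠ c → ∃ a ∈ S, g a = c := by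
    intro c hc hbc
    obtain ⟨a, ha, rfl⟩ := hgs c hc
    rcases mem_insert.1 ha with rfl | ha
    · exact absurd rfl hbc
    · exact ⟨a, ha, rfl⟩
  refine ⟨L', g b, hgb, hLS, fun u _ => by rw [hLb, hbL], by rw [hLb], ?_, ?_, ?_⟩
  · intro u hu
    rcases mem_insert.1 hu with rfl | hu
    · intro x hx y hy h
      rw [hbL, hbL] at h
      exact hg hx hy h
    · intro x hx y hy h
      rcases mem_insert.1 hx with hxb | hx <;> rcases mem_insert.1 hy with hyb | hy
      · rw [hxb, hyb]
      · rw [hxb, hLb, hLS u hu y hy] at h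
        exact absurd h.symm (hgS u hu y hy)
      · rw [hyb, hLb, hLS u hu x hx] at h
        exact absurd h (hgS u hu x hx)
      · rw [hLS u hu x hx, hLS u hu y hy] at h
        exact hrow u hu hx hy h
  · intro c
    rw [hcount, card_insert_of_notMem hb]
    have h1 := hN c
    have h2 := hdeg c
    have h3 := hrange c
    obtain ⟨x, hx⟩ := hpar c
    by_cases hbc : g b = c
    · subst hbc
      have h4 : ¬ ∃ a ∈ S, g a = g b := fun ⟨a, ha, h⟩ => hgne a ha h
      simp [h4, hgb] at *
      omega
    · have h5 : (c ∈ F.erase (g b)) ↔ c ∈ F := by simp [Ne.symm hbc]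
      by_cases h4 : ∃ a ∈ S, g a = c
      · simp only [h4, h5, hbc, if_true, if_false]
        omega
      -- An unused symbol is not tight. By parity its slack is even, hence at least 2, whereas 1
      -- would not suffice for the next stage.
      · have h6 : #{a ∈ insert b S | R a c} ≠ k + 1 := fun h => h4 (h3 h hbc)
        simp only [h4, h5, hbc, if_false]
        split_ifs at * <;> omega
  · intro c
    rw [hcount]
    have h1 := hpar c
    by_cases hbc : g b = c
    · subst hbc
      have h4 : ¬ ∃ a ∈ S, g a = g b := fun ⟨a, ha, h⟩ => hgne a ha h
      simp only [h4, hgb, if_true, if_false, mem_erase, ne_eq, not_true, false_and] at *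
      simpa using h1
    · have h5 : (c ∈ F.erase (g b)) ↔ c ∈ F := by simp [Ne.symm hbc]
      simp only [h5, hbc, if_false, Nat.even_iff] at *
      split_ifs at * <;> omega

open Finset in
/-- A square array with distinct entries in every row extends to a larger one which is symmetric
outside the given block and whose new diagonal entries are the elements of `F`, provided that every
symbol occurs sufficiently often and with the right parity. -/
theorem exists_symm_extension {V C : Type*} [Fintype V] [Fintype C] [DecidableEq V]
    [DecidableEq C] (hVC : Fintype.card V = Fintype.card C) (k : ℕ) :
    ∀ (S : Finset V) (F : Finset C) (L : V → V → C), #Sᶜ = k → #F = k →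
    (∀ u ∈ S, Set.InjOn (L u) S) →
    (∀ c, #S + (if c ∈ F then 1 else 0) ≤ rowCount S L c + k) →
    (∀ c, Even (rowCount S L c + (if c ∈ F then 1 else 0) + Fintype.card C)) →
    ∃ L' : V → V → C, (∀ u ∈ S, ∀ v ∈ S, L' u v = L u v) ∧ (∀ u, Function.Injective (L' u)) ∧
      (∀ u v, ¬ (u ∈ S ∧ v ∈ S) → L' u v = L' v u) ∧
      Set.InjOn (fun u => L' u u) (Sᶜ : Finset V) ∧ ∀ u ∉ S, L' u u ∈ F := by
  induction k with
  | zero =>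
    intro S F L hS hF hrow _ _
    obtain rfl : S = univ := by simpa using hS
    exact ⟨L, fun _ _ _ _ => rfl, fun u => by simpa [Set.injOn_univ] using hrow u (mem_univ u),
      by simp, by simp, by simp⟩
  | succ k ih =>
    intro S F L hS hF hrow hN hpar
    obtain ⟨b, hb⟩ : Sᶜ.Nonempty := card_pos.1 (by omega)
    have hb' : b ∉ S := by simpa using hb
    have hcS : #S + #Sᶜ = Fintype.card V := card_add_card_compl S
    obtain ⟨L₁, d, hd, h1, h2, h3, h4, h5, h6⟩ :=
      exists_extend_one hb' (k := k) (by omega) hF hrow hN hpar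
    have hc : (insert b S)ᶜ = Sᶜ.erase b := by
      ext; simp
    obtain ⟨L₂, g1, g2, g3, g4, g5⟩ := ih (insert b S) (F.erase d) L₁
      (by rw [hc, card_erase_of_mem hb]; omega) (by rw [card_erase_of_mem hd]; omega) h4 h5 h6
    have hbb : L₂ b b = d := by
      rw [g1 b (mem_insert_self b S) b (mem_insert_self b S), h3]
    refine ⟨L₂, ?_, g2, ?_, ?_, ?_⟩
    · intro u hu v hv
      rw [g1 u (mem_insert_of_mem hu) v (mem_insert_of_mem hv), h1 u hu v hv]
    · intro u v huv
      by_cases h : u ∈ insert b S ∧ v ∈ insert b S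
      · rw [g1 u h.1 v h.2, g1 v h.2 u h.1]
        rcases mem_insert.1 h.1 with rfl | hu
        · exact (h2 v h.2).symm
        · rcases mem_insert.1 h.2 with rfl | hv
          · exact h2 u h.1
          · exact absurd ⟨hu, hv⟩ huv
      · exact g3 u v h
    · have hmem : ∀ u, u ∉ S → u ≠ b → L₂ u u ∈ F.erase d := fun u hu hub =>
        g5 u (by simp [hu, hub])
      intro u hu v hv huv
      have hu' : u ∉ S := by simpa using hu
      have hv' : v ∉ S := by simpa using hv
      by_cases hub : u = b <;> by_cases hvb : v = b
      · rw [hub, hvb]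
      · subst hub
        have := hmem v hv' hvb
        simp only [hbb] at huv
        simp [← huv] at this
      · subst hvb
        have := hmem u hu' hub
        simp only [hbb] at huv
        simp [huv] at this
      · exact g4 (by simp [hu', hub]) (by simp [hv', hvb]) huv
    · intro u hu
      by_cases hub : u = b
      · rw [hub, hbb]; exact hd
      · exact mem_of_mem_erase (g5 u (by simp [hu, hub]))

/-! ### Greedy completion of the initial block -/

open Finset in
/-- Greedy symmetric completion of a partially filled array. -/
theorem exists_symm_fill {V C : Type*} [Fintype C] [DecidableEq V] [DecidableEq C]
    (A : Finset V) (hA : 2 * #A ≤ Fintype.card C) (P : V → V → Prop) (hPr : ∀ u, P u u)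
    (hPs : ∀ u v, P u v → P v u) (L₀ : V → V → C)
    (hL₀ : ∀ u ∈ A, Set.InjOn (L₀ u) {v | v ∈ A ∧ P u v}) :
    ∃ L : V → V → C, (∀ u v, P u v → L u v = L₀ u v) ∧ (∀ u ∈ A, Set.InjOn (L u) A) ∧
      ∀ u ∈ A, ∀ v ∈ A, ¬ P u v → L u v = L v u := by
  have key : ∀ T : Finset (Sym2 V), ∃ L : V → V → C, (∀ u v, P u v → L u v = L₀ u v) ∧
      (∀ u ∈ A, Set.InjOn (L u) {v | v ∈ A ∧ (P u v ∨ s(u, v) ∈ T)}) ∧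
      ∀ u ∈ A, ∀ v ∈ A, ¬ P u v → s(u, v) ∈ T → L u v = L v u := by
    intro T
    induction T using Finset.induction_on with
    | empty => exact ⟨L₀, fun _ _ _ => rfl, by simpa using hL₀, by simp⟩
    | insert e T he ih =>
      obtain ⟨L, h1, h2, h3⟩ := ih
      induction e with | _ a b
      by_cases hab : P a b ∨ ¬ (a ∈ A ∧ b ∈ A)
      · have hkey : ∀ u ∈ A, ∀ v ∈ A, s(u, v) = s(a, b) → P u v := by
          intro u hu v hv h
          rcases Sym2.eq_iff.1 h with ⟨rfl, rfl⟩ | ⟨rfl, rfl⟩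
          · exact hab.resolve_right (fun h => h ⟨hu, hv⟩)
          · exact hPs _ _ (hab.resolve_right (fun h => h ⟨hv, hu⟩))
        refine ⟨L, h1, ?_, ?_⟩
        · intro u hu
          refine (h2 u hu).mono ?_
          rintro v ⟨hv, h⟩
          refine ⟨hv, ?_⟩
          rw [mem_insert] at h
          rcases h with h | h | h
          · exact Or.inl h
          · exact Or.inl (hkey u hu v hv h)
          · exact Or.inr h
        · intro u hu v hv hP h
          rcases mem_insert.1 h with h | h
          · exact absurd (hkey u hu v hv h) hP
          · exact h3 u hu v hv hP h
      · push Not at hab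
        obtain ⟨hPab, ha, hb⟩ := hab
        have hne : a ≠ b := fun h => hPab (h ▸ hPr a)
        -- At most `2 * (#A - 1)` symbols are forbidden, fewer than the number of colours.
        obtain ⟨c, hc⟩ : ∃ c, c ∉ (A.erase b).image (L a) ∪ (A.erase a).image (L b) := by
          by_contra! hcon
          have h4 : (A.erase b).image (L a) ∪ (A.erase a).image (L b) = univ :=
            eq_univ_iff_forall.2 hcon
          have h5 := card_union_le ((A.erase b).image (L a)) ((A.erase a).image (L b))
          have h6 : #((A.erase b).image (L a)) ≤ #A - 1 :=
            card_image_le.trans (card_erase_of_mem hb).le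
          have h7 : #((A.erase a).image (L b)) ≤ #A - 1 :=
            card_image_le.trans (card_erase_of_mem ha).le
          have h8 : 0 < #A := card_pos.2 ⟨a, ha⟩
          rw [h4, card_univ] at h5
          omega
        simp only [mem_union, mem_image, mem_erase, not_or, not_exists, not_and, and_imp] at hc
        have hfresh : ∀ u x y, s(u, x) = s(a, b) → y ∈ A → y ≠ x → L u y ≠ c := by
          intro u x y h hy hyx
          rcases Sym2.eq_iff.1 h with ⟨rfl, rfl⟩ | ⟨rfl, rfl⟩
          · exact hc.1 y hyx hy
          · exact hc.2 y hyx hy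
        refine ⟨fun u v => if s(u, v) = s(a, b) then c else L u v, ?_, ?_, ?_⟩
        · intro u v hP
          have : s(u, v) ≠ s(a, b) := by
            intro h
            rcases Sym2.eq_iff.1 h with ⟨rfl, rfl⟩ | ⟨rfl, rfl⟩
            · exact hPab hP
            · exact hPab (hPs _ _ hP)
          simp only [this, if_false]
          exact h1 u v hP
        · rintro u hu x ⟨hx, hx'⟩ y ⟨hy, hy'⟩ h
          simp only at h
          by_contra hxy
          split_ifs at h with e1 e2 e2
          · exact hxy (Sym2.congr_right.1 (e1.trans e2.symm))
          · exact hfresh u x y e1 hy (Ne.symm hxy) h.symm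
          · exact hfresh u y x e2 hx hxy h
          · refine hxy (h2 u hu ⟨hx, ?_⟩ ⟨hy, ?_⟩ h)
            · simpa [e1] using hx'
            · simpa [e2] using hy'
        · intro u hu v hv hP h
          simp only [Sym2.eq_swap (a := v) (b := u)]
          split_ifs with e1
          · rfl
          · exact h3 u hu v hv hP ((mem_insert.1 h).resolve_left e1)
  obtain ⟨L, h1, h2, h3⟩ := key A.sym2
  have hmem : ∀ u ∈ A, ∀ v ∈ A, s(u, v) ∈ A.sym2 := fun u hu v hv => mk_mem_sym2_iff.2 ⟨hu, hv⟩
  exact ⟨L, h1, fun u hu x hx y hy h => h2 u hu ⟨hx, Or.inr (hmem u hu x hx)⟩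
    ⟨hy, Or.inr (hmem u hu y hy)⟩ h, fun u hu v hv hP => h3 u hu v hv hP (hmem u hu v hv)⟩

/-! ### Distinct labels for darts, and parity of symbol counts -/

namespace SimpleGraph

-- Darts will carry distinct colours, each differing from the diagonal entry of its row. Hall's
-- condition holds because two darts with different first ends together allow all of `U`, while a
-- set of darts with a common first end omits a reversed dart and so has at most `#U - 1` members.
open Finset in
theorem exists_dart_labelling {V : Type*} [Fintype V] [DecidableEq V] (J : SimpleGraph V)
    [Fintype J.Dart] [Nonempty J.Dart] (U : Finset V) (hU : #U = Fintype.card J.Dart) :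
    ∃ φ : J.Dart → V, Function.Injective φ ∧ (∀ d, φ d ≠ d.fst) ∧ ∀ v, v ∈ U ↔ ∃ d, φ d = v := by
  classical
  have hall : ∀ s : Finset J.Dart, #s ≤ #(s.biUnion fun d => U.erase d.fst) := by
    intro s
    rcases s.eq_empty_or_nonempty with rfl | ⟨d, hd⟩
    · simp
    by_cases h : ∃ d' ∈ s, d'.fst ≠ d.fst
    · obtain ⟨d', hd', hne⟩ := h
      refine (card_le_univ s).trans (hU.symm.le.trans (card_le_card fun v hv => ?_))
      rw [mem_biUnion]
      by_cases hvd : v = d.fst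
      · exact ⟨d', hd', mem_erase.2 ⟨by rw [hvd]; exact hne.symm, hv⟩⟩
      · exact ⟨d, hd, mem_erase.2 ⟨hvd, hv⟩⟩
    · push Not at h
      have h1 : d.symm ∉ s := fun hs => d.fst_ne_snd (h _ hs).symm
      have h2 : #s < Fintype.card J.Dart := card_lt_univ_of_notMem h1
      have h3 : #(U.erase d.fst) ≤ #(s.biUnion fun d => U.erase d.fst) :=
        card_le_card (subset_biUnion_of_mem (fun d : J.Dart => U.erase d.fst) hd)
      have h4 := pred_card_le_card_erase (s := U) (a := d.fst)
      omega
  obtain ⟨φ, hφ, hmem⟩ := (all_card_le_biUnion_card_iff_exists_injective _).1 hall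
  refine ⟨φ, hφ, fun d => (mem_erase.1 (hmem d)).1, fun v => ?_⟩
  have h1 : univ.image φ = U := by
    refine eq_of_subset_of_card_le (fun v hv => ?_) ?_
    · obtain ⟨d, -, rfl⟩ := mem_image.1 hv
      exact (mem_erase.1 (hmem d)).2
    · rw [card_image_of_injective _ hφ, card_univ, hU]
  rw [← h1]
  simp

end SimpleGraph

open Finset in
theorem rowCount_eq_card_filter_product {V C : Type*} [DecidableEq C] {A : Finset V}
    {L : V → V → C} (hL : ∀ u ∈ A, Set.InjOn (L u) A) (c : C) :
    rowCount A L c = #{p ∈ A ×ˢ A | L p.1 p.2 = c} := by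
  classical
  have h : {u ∈ A | ∃ v ∈ A, L u v = c} = image Prod.fst {p ∈ A ×ˢ A | L p.1 p.2 = c} := by
    ext u
    simp only [mem_filter, mem_image, mem_product, Prod.exists, exists_and_right, exists_eq_right]
    exact ⟨fun ⟨hu, v, hv, h⟩ => ⟨v, ⟨hu, hv⟩, h⟩, fun ⟨v, ⟨hu, hv⟩, h⟩ => ⟨hu, v, hv, h⟩⟩
  rw [rowCount, h, card_image_of_injOn]
  rintro ⟨u, v⟩ h1 ⟨u', v'⟩ h2 rfl
  simp only [coe_filter, mem_product, Set.mem_ofPred_eq] at h1 h2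
  rw [hL u h1.1.1 h1.1.2 h2.1.2 (h1.2.trans h2.2.symm)]

-- Transposition is a fixed-point-free involution on the pairs counted.
open Finset in
theorem even_card_filter_product_of_symm {V : Type*} (A : Finset V) (Q : V → V → Prop)
    [DecidablePred fun p : V × V => Q p.1 p.2] (hQr : ∀ u, ¬ Q u u)
    (hQs : ∀ u ∈ A, ∀ v ∈ A, Q u v → Q v u) :
    Even #{p ∈ A ×ˢ A | Q p.1 p.2} := by
  rw [← ZMod.natCast_eq_zero_iff_even, card_eq_sum_ones, Nat.cast_sum]
  refine sum_involution (fun p _ => p.swap) ?_ ?_ ?_ ?_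
  · intros; simpa using CharTwo.add_self_eq_zero (1 : ZMod 2)
  · rintro ⟨u, v⟩ h _ heq
    simp only [mem_filter] at h
    simp only [Prod.swap_prod_mk, Prod.mk.injEq] at heq
    exact hQr u (heq.1 ▸ h.2)
  · rintro ⟨u, v⟩ h
    simp only [mem_filter, mem_product, Prod.swap_prod_mk] at h ⊢
    exact ⟨h.1.symm, hQs u h.1.1 v h.1.2 h.2⟩
  · intros; simp

/-! ### Matchings as finite sets of edges -/

namespace SimpleGraph

open Finset in
/-- A finite set of pairwise disjoint edges of `J`. -/
structure IsEdgeMatching {V : Type*} (J : SimpleGraph V) (M : Finset (Sym2 V)) : Prop where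
  mem_edgeSet : ∀ e ∈ M, e ∈ J.edgeSet
  eq_of_mem : ∀ e ∈ M, ∀ f ∈ M, ∀ v, v ∈ e → v ∈ f → e = f

namespace IsEdgeMatching

variable {V : Type*} {J : SimpleGraph V} {M : Finset (Sym2 V)}

theorem mono (h : J.IsEdgeMatching M) {N : Finset (Sym2 V)} (hN : N ⊆ M) :
    J.IsEdgeMatching N :=
  ⟨fun e he => h.1 e (hN he), fun e he f hf => h.2 e (hN he) f (hN hf)⟩

theorem card_filter_mem [Fintype V] [DecidableEq V] (h : J.IsEdgeMatching M) :
    (Finset.univ.filter fun v => ∃ e ∈ M, v ∈ e).card = 2 * M.card := by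
  have h1 : (Finset.univ.filter fun v => ∃ e ∈ M, v ∈ e) = M.biUnion Sym2.toFinset := by
    ext v; simp
  rw [h1, Finset.card_biUnion]
  · rw [Finset.sum_congr rfl fun e he => Sym2.card_toFinset_of_not_isDiag e
      (J.not_isDiag_of_mem_edgeSet (h.1 e he))]
    simp [mul_comm]
  · intro e he f hf hef
    rw [Function.onFun, Finset.disjoint_left]
    intro v hv hv'
    exact hef (h.2 e he f hf v (Sym2.mem_toFinset.1 hv) (Sym2.mem_toFinset.1 hv'))

/-- A colour for each vertex, constant exactly on the edges of the matching. -/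
theorem exists_representative (h : J.IsEdgeMatching M) :
    ∃ d : V → V, (∀ v, (∀ e ∈ M, v ∉ e) → d v = v) ∧ (∀ e ∈ M, ∃ x ∈ e, ∀ v ∈ e, d v = x) := by
  classical
  refine ⟨fun v => if hv : ∃ e ∈ M, v ∈ e then (Quot.out hv.choose).1 else v, ?_, ?_⟩
  · intro v hv
    have : ¬ ∃ e ∈ M, v ∈ e := by push Not; exact hv
    simp [this]
  · intro e he
    refine ⟨(Quot.out e).1, Sym2.out_fst_mem e, fun v hv => ?_⟩
    have hv' : ∃ e ∈ M, v ∈ e := ⟨e, he, hv⟩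
    have : hv'.choose = e := h.2 _ hv'.choose_spec.1 _ he v hv'.choose_spec.2 hv
    simp only [hv', dif_pos, this]

end IsEdgeMatching

/-! ### Construction of the array -/

open Finset in
/-- If `|E(J)| + |M| = m` for a matching `M` of a graph `J` on `2m` vertices covering at most `m` of
them, then the complement of `J` has a total colouring with `2m` colours. -/
theorem exists_row_coloring_compl {V : Type*} [Fintype V] [DecidableEq V] (J : SimpleGraph V)
    [Fintype J.Dart] [Nonempty J.Dart] {M : Finset (Sym2 V)} (hM : J.IsEdgeMatching M)
    (hcount : Fintype.card J.Dart + 2 * #M = Fintype.card V) (A : Finset V)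
    (hA : 2 * #A = Fintype.card V) (hJA : ∀ u v, J.Adj u v → u ∈ A) :
    ∃ L : V → V → V, (∀ u, Function.Injective (L u)) ∧ (∀ u v, ¬ J.Adj u v → L u v = L v u) ∧
      ∀ u v, L u u = L v v → u = v ∨ J.Adj u v := by
  classical
  -- The colours are the vertices themselves. Those not covered by `M` are exactly as many as the
  -- darts of `J`, so each can be used on one dart.
  set U : Finset V := univ.filter fun v => ∀ e ∈ M, v ∉ e with hUdef
  have hU : #U = Fintype.card J.Dart := by
    have h1 := card_filter_add_card_filter_not (s := univ) (fun v => ∃ e ∈ M, v ∈ e)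
    rw [hM.card_filter_mem] at h1
    have h2 : U = univ.filter fun v => ¬ ∃ e ∈ M, v ∈ e := by
      ext v; simp [U]
    rw [h2]
    rw [card_univ] at h1
    omega
  have hUmem : ∀ v, v ∈ U ↔ ∀ e ∈ M, v ∉ e := fun v => by simp [U]
  have hMA : ∀ e ∈ M, ∀ v ∈ e, v ∈ A := by
    intro e he v hv
    have h1 := hM.1 e he
    rw [← Sym2.other_spec hv] at h1
    exact hJA _ _ h1
  obtain ⟨φ, hφ, hφne, hφU⟩ := J.exists_dart_labelling U hU
  obtain ⟨d, hd1, hd2⟩ := hM.exists_representative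
  have hdU : ∀ v ∈ U, d v = v := fun v hv => hd1 v ((hUmem v).1 hv)
  have hdU' : ∀ v, d v ∈ U → v ∈ U := by
    intro v hv
    by_contra hvU
    rw [hUmem] at hvU
    push Not at hvU
    obtain ⟨e, he, hve⟩ := hvU
    obtain ⟨x, hx, hx'⟩ := hd2 e he
    rw [hx' v hve, hUmem] at hv
    exact hv e he hx
  have hdA : ∀ v ∈ A, d v ∈ A := by
    intro v hv
    by_cases hvU : v ∈ U
    · rwa [hdU v hvU]
    · rw [hUmem] at hvU
      push Not at hvU
      obtain ⟨e, he, hve⟩ := hvU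
      obtain ⟨x, hx, hx'⟩ := hd2 e he
      rw [hx' v hve]
      exact hMA e he x hx
  have hdeq : ∀ u, u ∉ U → ∃ e ∈ M, u ∈ e ∧ ∀ v, d v = d u ↔ v ∈ e := by
    intro u hu
    rw [hUmem] at hu
    push Not at hu
    obtain ⟨e, he, hue⟩ := hu
    obtain ⟨x, hx, hx'⟩ := hd2 e he
    refine ⟨e, he, hue, fun v => ?_⟩
    rw [hx' u hue]
    refine ⟨fun h => ?_, hx' v⟩
    by_cases hvU : v ∈ U
    · rw [hdU v hvU] at h; rwa [h]
    · rw [hUmem] at hvU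
      push Not at hvU
      obtain ⟨f, hf, hvf⟩ := hvU
      obtain ⟨y, hy, hy'⟩ := hd2 f hf
      rw [hy' v hvf] at h
      subst h
      rwa [hM.2 e he f hf y hx hy]
  -- Prescribed cells: the two darts of an edge of `J` get different colours, and the ends of an
  -- edge of `M` share their diagonal colour.
  let L₀ : V → V → V := fun u v => if h : J.Adj u v then φ ⟨(u, v), h⟩ else d u
  have hL₀J : ∀ u v (h : J.Adj u v), L₀ u v = φ ⟨(u, v), h⟩ := fun u v h => by simp [L₀, h]
  have hL₀d : ∀ u, L₀ u u = d u := fun u => by simp [L₀]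
  have hdφ : ∀ u v (h : J.Adj u v), d u ≠ φ ⟨(u, v), h⟩ := by
    intro u v h heq
    have h1 : d u ∈ U := heq ▸ (hφU _).2 ⟨_, rfl⟩
    rw [hdU u (hdU' u h1)] at heq
    exact hφne _ heq.symm
  obtain ⟨L₁, hL₁, hrow, hsymm⟩ := exists_symm_fill A hA.le (fun u v => u = v ∨ J.Adj u v)
    (fun u => Or.inl rfl) (fun u v h => h.imp Eq.symm fun h => h.symm) L₀ (by
      rintro u hu x ⟨hx, hux⟩ y ⟨hy, huy⟩ h
      rcases hux with rfl | hux <;> rcases huy with rfl | huy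
      · rfl
      · rw [hL₀d, hL₀J _ _ huy] at h
        exact absurd h (hdφ _ _ _)
      · rw [hL₀d, hL₀J _ _ hux] at h
        exact absurd h.symm (hdφ _ _ _)
      · rw [hL₀J _ _ hux, hL₀J _ _ huy] at h
        have := hφ h
        simp only [Dart.mk.injEq, Prod.mk.injEq] at this
        exact this.2)
  have hdiag : ∀ u, L₁ u u = d u := fun u => by rw [hL₁ u u (Or.inl rfl), hL₀d]
  have hdart : ∀ u v (h : J.Adj u v), L₁ u v = φ ⟨(u, v), h⟩ := fun u v h => by
    rw [hL₁ u v (Or.inr h), hL₀J]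
  have hcompl : #Aᶜ = #A := by
    have := card_add_card_compl A
    omega
  have hcU : ∀ c ∉ A, c ∈ U := fun c hc => (hUmem c).2 fun e he hce => hc (hMA e he c hce)
  have hcnt : ∀ c, rowCount A L₁ c = #{u ∈ A | d u = c} + (if c ∈ U then 1 else 0) +
      #{p ∈ A ×ˢ A | (¬ (p.1 = p.2 ∨ J.Adj p.1 p.2)) ∧ L₁ p.1 p.2 = c} := by
    intro c
    have e1 : #{u ∈ A | d u = c} = #{p ∈ A ×ˢ A | p.1 = p.2 ∧ L₁ p.1 p.2 = c} := by
      refine card_bij (fun u _ => (u, u)) ?_ ?_ ?_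
      · intro u hu
        simpa [hdiag] using hu
      · intro u _ v _ h
        simpa using h
      · rintro ⟨u, v⟩ h
        simp only [mem_filter, mem_product] at h
        obtain ⟨⟨hu, hv⟩, rfl, h⟩ := h
        exact ⟨u, by simpa [hu, hdiag] using h, rfl⟩
    have e2 : (if c ∈ U then 1 else 0) = #{p ∈ A ×ˢ A | J.Adj p.1 p.2 ∧ L₁ p.1 p.2 = c} := by
      symm
      split_ifs with hc
      · obtain ⟨⟨⟨u, v⟩, huv⟩, hd⟩ := (hφU c).1 hc
        rw [card_eq_one]
        refine ⟨(u, v), ?_⟩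
        ext ⟨x, y⟩
        simp only [mem_filter, mem_product, mem_singleton, Prod.mk.injEq]
        constructor
        · rintro ⟨-, hxy, h⟩
          rw [hdart x y hxy, ← hd] at h
          have := hφ h
          simpa using this
        · rintro ⟨rfl, rfl⟩
          exact ⟨⟨hJA _ _ huv, hJA _ _ huv.symm⟩, huv, by rw [hdart _ _ huv, hd]⟩
      · rw [card_eq_zero, filter_eq_empty_iff]
        rintro ⟨x, y⟩ - ⟨hxy, h⟩
        rw [hdart x y hxy] at h
        exact hc ((hφU c).2 ⟨_, h⟩)
    rw [rowCount_eq_card_filter_product hrow, e1, e2, ← card_union_of_disjoint,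
      ← card_union_of_disjoint]
    · rw [← filter_or, ← filter_or]
      congr 1
      refine filter_congr fun p _ => ?_
      tauto
    · rw [← filter_or, disjoint_filter]
      tauto
    · rw [disjoint_filter]
      rintro ⟨x, y⟩ - ⟨h, -⟩ ⟨h', -⟩
      exact h'.ne h
  have heven : ∀ c, Even #{p ∈ A ×ˢ A | (¬ (p.1 = p.2 ∨ J.Adj p.1 p.2)) ∧ L₁ p.1 p.2 = c} := by
    intro c
    refine even_card_filter_product_of_symm A
      (fun u v => (¬ (u = v ∨ J.Adj u v)) ∧ L₁ u v = c) (by simp) ?_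
    rintro u hu v hv ⟨h, rfl⟩
    refine ⟨fun h' => h (h'.imp Eq.symm fun h => h.symm), (hsymm u hu v hv h).symm⟩
  -- A colour of `U` occurs on one dart and once on the diagonal, either inside `A` or reserved for
  -- the later diagonal. Any other colour lies in `A` and occurs on the diagonal twice or not at
  -- all.
  have hdcount : ∀ c, Even (#{u ∈ A | d u = c} + (if c ∈ U then 1 else 0) +
      if c ∈ Aᶜ then 1 else 0) := by
    intro c
    by_cases hcA : c ∈ A
    · by_cases hc : c ∈ U
      · have : #{u ∈ A | d u = c} = 1 := by
          rw [card_eq_one]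
          refine ⟨c, ?_⟩
          ext u
          simp only [mem_filter, mem_singleton]
          constructor
          · rintro ⟨-, h⟩
            rw [← h, hdU u (hdU' u (h ▸ hc))]
          · rintro rfl; exact ⟨hcA, hdU u hc⟩
        simp [this, hc, hcA]
      · simp only [hc, if_false, mem_compl, hcA, not_true, add_zero]
        rcases (filter (fun u => d u = c) A).eq_empty_or_nonempty with h | ⟨u, hu⟩
        · simp [h]
        · obtain ⟨huA, rfl⟩ := mem_filter.1 hu
          have huU : u ∉ U := fun h => hc (by rwa [hdU u h])
          obtain ⟨e, he, hue, h⟩ := hdeq u huU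
          have : filter (fun v => d v = d u) A = e.toFinset := by
            ext v
            simp only [mem_filter, Sym2.mem_toFinset, h]
            exact ⟨And.right, fun hv => ⟨hMA e he v hv, hv⟩⟩
          rw [this, Sym2.card_toFinset_of_not_isDiag e (J.not_isDiag_of_mem_edgeSet (hM.1 e he))]
          exact even_two
    · have : #{u ∈ A | d u = c} = 0 := by
        rw [card_eq_zero, filter_eq_empty_iff]
        rintro u hu rfl
        exact hcA (hdA u hu)
      simp [this, hcA, hcU c hcA]
  -- As `A` is half of the vertices, the count only requires that every colour outside `A` occur in
  -- the block. It does: such a colour lies in `U` and labels a dart. The later diagonal uses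
  -- colours outside `A`, so it cannot clash with the diagonal of the block.
  obtain ⟨L, g1, g2, g3, g4, g5⟩ := exists_symm_extension (C := V) rfl #A A Aᶜ L₁ hcompl hcompl
    hrow (by
      intro c
      rw [hcnt c]
      split_ifs with h1 h2 h2
      · omega
      · exact absurd (hcU c (by simpa using h1)) h2
      · omega
      · omega) (by
      intro c
      rw [hcnt c]
      have h1 := hdcount c
      have h2 := heven c
      rw [← hA]
      simp only [Nat.even_iff] at *
      omega)
  refine ⟨L, g2, ?_, ?_⟩
  · intro u v huv
    by_cases h : u ∈ A ∧ v ∈ A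
    · rw [g1 u h.1 v h.2, g1 v h.2 u h.1]
      by_cases he : u = v
      · rw [he]
      · exact hsymm u h.1 v h.2 (by tauto)
    · exact g3 u v h
  · intro u v huv
    by_cases hu : u ∈ A <;> by_cases hv : v ∈ A
    · rw [g1 u hu u hu, g1 v hv v hv, hdiag, hdiag] at huv
      by_cases huU : u ∈ U
      · left
        have hvU : v ∈ U := hdU' v (by rw [← huv, hdU u huU]; exact huU)
        rwa [hdU u huU, hdU v hvU] at huv
      · obtain ⟨e, he, hue, h⟩ := hdeq u huU
        have hve : v ∈ e := (h v).1 huv.symm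
        by_cases hne : u = v
        · exact Or.inl hne
        · right
          have h1 := hM.1 e he
          rwa [(Sym2.mem_and_mem_iff hne).1 ⟨hue, hve⟩] at h1
    · have := g5 v hv
      rw [← huv, g1 u hu u hu, hdiag] at this
      exact absurd (hdA u hu) (by simpa using this)
    · have := g5 u hu
      rw [huv, g1 v hv v hv, hdiag] at this
      exact absurd (hdA v hv) (by simpa using this)
    · exact Or.inl (g4 (by simpa using hu) (by simpa using hv) huv)

end SimpleGraph

/-! ### Choosing the edges and the matching in the complement -/

namespace SimpleGraph

open Finset

theorem sum_degrees_eq_two_mul_ncard {V : Type*} [Fintype V] (J : SimpleGraph V)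
    [DecidableRel J.Adj] : ∑ v, J.degree v = 2 * J.edgeSet.ncard := by
  classical
  rw [sum_degrees_eq_twice_card_edges, Set.ncard_eq_toFinset_card']
  rfl

theorem bddAbove_card_matchings {V : Type*} [Finite V] (J : SimpleGraph V) :
    BddAbove {n : ℕ | ∃ M : J.Subgraph, M.IsMatching ∧ M.edgeSet.ncard = n} := by
  refine ⟨J.edgeSet.ncard, ?_⟩
  rintro n ⟨M, -, rfl⟩
  exact Set.ncard_le_ncard M.edgeSet_subset (Set.toFinite _)

theorem exists_isEdgeMatching_card_eq {V : Type*} [Finite V] (J : SimpleGraph V) :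
    ∃ M : Finset (Sym2 V), J.IsEdgeMatching M ∧ #M = J.matchingNumber := by
  obtain ⟨M, hM, hcard⟩ := Nat.sSup_mem
    (⟨0, (⊥ : J.Subgraph), by simp [Subgraph.IsMatching], by simp⟩ :
      {n : ℕ | ∃ M : J.Subgraph, M.IsMatching ∧ M.edgeSet.ncard = n}.Nonempty)
    (bddAbove_card_matchings J)
  refine ⟨(Set.toFinite M.edgeSet).toFinset, ⟨?_, ?_⟩, ?_⟩
  · intro e he
    exact M.edgeSet_subset ((Set.Finite.mem_toFinset _).1 he)
  · intro e he f hf v hve hvf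
    rw [Set.Finite.mem_toFinset] at he hf
    obtain ⟨x, rfl⟩ := hve
    obtain ⟨y, rfl⟩ := hvf
    exact congrArg (fun z => s(v, z)) (hM.eq_of_adj_left he hf)
  · rw [← Set.ncard_eq_toFinset_card]
    exact hcard

theorem IsEdgeMatching.card_le_matchingNumber {V : Type*} [Finite V] {J : SimpleGraph V}
    {M : Finset (Sym2 V)} (hM : J.IsEdgeMatching M) : #M ≤ J.matchingNumber := by
  refine le_csSup (bddAbove_card_matchings J) ⟨
    { verts := {v | ∃ e ∈ M, v ∈ e}
      Adj := fun v w => s(v, w) ∈ M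
      adj_sub := fun h => hM.1 _ h
      edge_vert := fun {v w} h => ⟨s(v, w), h, Sym2.mem_mk_left v w⟩
      symm := ⟨fun v w h => by rwa [Sym2.eq_swap]⟩ }, ?_, ?_⟩
  · rintro v ⟨e, he, ⟨w, rfl⟩⟩
    refine ⟨w, he, fun x hx => ?_⟩
    exact Sym2.congr_right.1 (hM.2 _ hx _ he v (Sym2.mem_mk_left _ _) (Sym2.mem_mk_left _ _))
  · rw [← Set.ncard_coe_finset]
    congr 1
    ext e
    induction e with | _ a b
    simp [Subgraph.mem_edgeSet]

theorem IsEdgeMatching.insert {V : Type*} [DecidableEq V] {J : SimpleGraph V}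
    {M : Finset (Sym2 V)} (hM : J.IsEdgeMatching M) {a b : V} (hab : J.Adj a b)
    (ha : ∀ e ∈ M, a ∉ e) (hb : ∀ e ∈ M, b ∉ e) :
    J.IsEdgeMatching (insert s(a, b) M) := by
  have h : ∀ e ∈ M, ∀ v ∈ s(a, b), v ∉ e := by
    intro e he v hv
    rcases Sym2.mem_iff.1 hv with rfl | rfl
    · exact ha e he
    · exact hb e he
  refine ⟨?_, ?_⟩
  · intro e he
    rcases mem_insert.1 he with rfl | he
    · exact hab
    · exact hM.1 e he
  · intro e he f hf v hve hvf
    rcases mem_insert.1 he with rfl | he <;> rcases mem_insert.1 hf with rfl | hf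
    · rfl
    · exact absurd hvf (h f hf v hve)
    · exact absurd hve (h e he v hvf)
    · exact hM.2 e he f hf v hve hvf

theorem IsEdgeMatching.exists_mem_of_card_eq_matchingNumber {V : Type*} [Finite V]
    {J : SimpleGraph V} {M : Finset (Sym2 V)} (hM : J.IsEdgeMatching M)
    (hmax : #M = J.matchingNumber) {a b : V} (hab : J.Adj a b) :
    (∃ e ∈ M, a ∈ e) ∨ ∃ e ∈ M, b ∈ e := by
  classical
  by_contra! h
  have h1 := (hM.insert hab h.1 h.2).card_le_matchingNumber
  rw [card_insert_of_notMem (fun h2 => h.1 _ h2 (Sym2.mem_mk_left a b))] at h1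
  omega

/-- In a graph in which any two edges meet or are joined by an edge, with enough edges, there are a
set of edges `E` and a matching `M ⊆ E` with `|E| + |M| = m` such that `E` covers at most `m`
vertices. -/
theorem exists_edges_and_matching {V : Type*} [Fintype V] [DecidableEq V] (J : SimpleGraph V)
    (hJ : ∀ e ∈ J.edgeSet, ∀ f ∈ J.edgeSet, ∃ x ∈ e, ∃ y ∈ f, x = y ∨ J.Adj x y)
    (hV : 0 < Fintype.card V) {m : ℕ} (hm : 2 ≤ m) (h : m ≤ J.edgeSet.ncard + J.matchingNumber) :
    ∃ E M : Finset (Sym2 V), (∀ e ∈ E, e ∈ J.edgeSet) ∧ M ⊆ E ∧ J.IsEdgeMatching M ∧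
      #E + #M = m ∧ #{v | ∃ e ∈ E, v ∈ e} ≤ m := by
  classical
  obtain ⟨M, hM, hMcard⟩ := J.exists_isEdgeMatching_card_eq
  by_cases hj : 2 * #M ≤ m
  · have hME : M ⊆ J.edgeFinset := fun e he => mem_edgeFinset.2 (hM.1 e he)
    obtain ⟨E, hE1, hE2, hE3⟩ := exists_subsuperset_card_eq (n := m - #M) hME (by omega) (by
      rw [Set.ncard_eq_toFinset_card'] at h
      have : J.edgeSet.toFinset = J.edgeFinset := rfl
      rw [this] at h
      omega)
    refine ⟨E, M, fun e he => mem_edgeFinset.1 (hE2 he), hE1, hM, by omega, ?_⟩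
    -- By maximality of `M`, each further edge covers at most one new vertex, so `E` covers at most
    -- `2 * #M + #(E \ M) = m` vertices.
    have hx : ∀ e ∈ E \ M, ∃ x, ∀ v ∈ e, (∃ f ∈ M, v ∈ f) ∨ v = x := by
      intro e he
      have he' : e ∈ J.edgeSet := mem_edgeFinset.1 (hE2 (mem_sdiff.1 he).1)
      induction e with | _ a b
      rcases hM.exists_mem_of_card_eq_matchingNumber hMcard he' with ha | hb
      · exact ⟨b, fun v hv => (Sym2.mem_iff.1 hv).imp (by rintro rfl; exact ha) id⟩
      · exact ⟨a, fun v hv => (Sym2.mem_iff.1 hv).symm.imp (by rintro rfl; exact hb) id⟩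
    have : Nonempty V := Fintype.card_pos_iff.1 hV
    choose! x hx using hx
    have hsub : (univ.filter fun v => ∃ e ∈ E, v ∈ e) ⊆
        (univ.filter fun v => ∃ e ∈ M, v ∈ e) ∪ (E \ M).image x := by
      intro v hv
      simp only [mem_filter, mem_univ, true_and, mem_union, mem_image] at hv ⊢
      obtain ⟨e, he, hve⟩ := hv
      by_cases heM : e ∈ M
      · exact Or.inl ⟨e, heM, hve⟩
      · exact (hx e (mem_sdiff.2 ⟨he, heM⟩) v hve).imp id fun h =>
          ⟨e, mem_sdiff.2 ⟨he, heM⟩, h.symm⟩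
    have h1 := card_le_card hsub
    have h2 := card_union_le (univ.filter fun v => ∃ e ∈ M, v ∈ e) ((E \ M).image x)
    have h3 : #((E \ M).image x) ≤ #(E \ M) := card_image_le
    have h4 := card_sdiff_add_card_eq_card hE1
    rw [hM.card_filter_mem] at h2
    omega
  · rcases Nat.even_or_odd' m with ⟨q, hq | hq⟩
    · obtain ⟨N, hN, hNq⟩ := exists_subset_card_eq (s := M) (n := q) (by omega)
      refine ⟨N, N, fun e he => hM.1 e (hN he), Subset.rfl, hM.mono hN, by omega, ?_⟩
      rw [(hM.mono hN).card_filter_mem]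
      omega
    · obtain ⟨f, hf⟩ : M.Nonempty := card_pos.1 (by omega)
      obtain ⟨N, hN, hNq⟩ := exists_subset_card_eq (s := M.erase f) (n := q) (by
        rw [card_erase_of_mem hf]; omega)
      obtain ⟨e, he⟩ : N.Nonempty := card_pos.1 (by omega)
      have hNM : N ⊆ M := hN.trans (erase_subset _ _)
      -- For `m = 2 * q + 1` one edge beyond the `q` edges of `N` is needed, and it may cover only
      -- one new vertex. An edge from `e ∈ N` to `f ∉ N` does this; `2 ≤ m` ensures that `N` is
      -- nonempty.
      obtain ⟨x, hxe, y, hyf, hxy⟩ := hJ e (hM.1 e (hNM he)) f (hM.1 f hf)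
      have hfN : f ∉ N := fun h => (mem_erase.1 (hN h)).1 rfl
      have hxy : J.Adj x y := by
        refine hxy.resolve_left ?_
        rintro rfl
        exact hfN (hM.2 e (hNM he) f hf x hxe hyf ▸ he)
      have hnot : s(x, y) ∉ N := fun h =>
        hfN (hM.2 _ (hNM h) f hf y (Sym2.mem_mk_right x y) hyf ▸ h)
      refine ⟨insert s(x, y) N, N, ?_, subset_insert _ _, hM.mono hNM, ?_, ?_⟩
      · intro e' he'
        rcases mem_insert.1 he' with rfl | he'
        · exact hxy
        · exact hM.1 _ (hNM he')
      · rw [card_insert_of_notMem hnot]; omega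
      · have hsub : (univ.filter fun v => ∃ e ∈ insert s(x, y) N, v ∈ e) ⊆
            insert y (univ.filter fun v => ∃ e ∈ N, v ∈ e) := by
          intro v hv
          simp only [mem_filter, mem_univ, true_and, mem_insert] at hv ⊢
          obtain ⟨e', rfl | he', hve⟩ := hv
          · rcases Sym2.mem_iff.1 hve with rfl | rfl
            · exact Or.inr ⟨e, he, hxe⟩
            · exact Or.inl rfl
          · exact Or.inr ⟨e', he', hve⟩
        have h1 := card_le_card hsub
        have h2 := card_insert_le y (univ.filter fun v => ∃ e ∈ N, v ∈ e)
        rw [(hM.mono hNM).card_filter_mem] at h2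
        omega

/-- The array is built for the subgraph formed by the chosen edges. Its exceptions to symmetry and
to distinctness on the diagonal are then also permitted by the larger graph `J`. -/
theorem exists_row_coloring_of_matchingNumber {V : Type*} [Fintype V] (J : SimpleGraph V)
    (hJ : ∀ e ∈ J.edgeSet, ∀ f ∈ J.edgeSet, ∃ x ∈ e, ∃ y ∈ f, x = y ∨ J.Adj x y)
    {m : ℕ} (hm : 2 ≤ m) (hV : Fintype.card V = 2 * m)
    (h : m ≤ J.edgeSet.ncard + J.matchingNumber) :
    ∃ L : V → V → V, (∀ u, Function.Injective (L u)) ∧ (∀ u v, ¬ J.Adj u v → L u v = L v u) ∧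
      ∀ u v, L u u = L v v → u = v ∨ J.Adj u v := by
  classical
  obtain ⟨E, M, hE, hME, hM, hcard, hcov⟩ := J.exists_edges_and_matching hJ (by omega) hm h
  have hJE : (fromEdgeSet (E : Set (Sym2 V))).edgeSet = E := by
    rw [edgeSet_fromEdgeSet, sdiff_eq_left, Set.disjoint_left]
    exact fun e he => J.not_isDiag_of_mem_edgeSet (hE e he)
  have hle : fromEdgeSet (E : Set (Sym2 V)) ≤ J := by
    rw [← edgeSet_subset_edgeSet, hJE]
    exact hE
  have hdart : Fintype.card (fromEdgeSet (E : Set (Sym2 V))).Dart = 2 * #E := by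
    rw [dart_card_eq_sum_degrees, sum_degrees_eq_two_mul_ncard, hJE, Set.ncard_coe_finset]
  obtain ⟨A, hA1, -, hA2⟩ := exists_subsuperset_card_eq (n := m) (subset_univ _) hcov
    (by rw [card_univ]; omega)
  have hMcard := card_le_card hME
  have : Nonempty (fromEdgeSet (E : Set (Sym2 V))).Dart := Fintype.card_pos_iff.1 (by omega)
  obtain ⟨L, h1, h2, h3⟩ := exists_row_coloring_compl (fromEdgeSet (E : Set (Sym2 V))) (M := M)
    ⟨fun e he => by rw [hJE]; exact hME he, hM.2⟩ (by omega) A (by omega) (by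
      intro u v huv
      refine hA1 ?_
      rw [mem_filter]
      rw [fromEdgeSet_adj] at huv
      exact ⟨mem_univ _, s(u, v), huv.1, Sym2.mem_mk_left u v⟩)
  exact ⟨L, h1, fun u v huv => h2 u v fun h => huv (hle h), fun u v huv =>
    (h3 u v huv).imp id fun h => hle h⟩

/-! ### The lower bound by parity -/

/-- A total colouring of a graph, recorded as a square array: the diagonal holds the colours of the
vertices. -/
structure IsRowColoring {V C : Type*} (G : SimpleGraph V) (L : V → V → C) : Prop where
  ne_diag : ∀ u v, G.Adj u v → L u v ≠ L u u
  eq_of_eq : ∀ u v w, G.Adj u v → G.Adj u w → L u v = L u w → v = w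
  symm : ∀ u v, G.Adj u v → L u v = L v u
  diag_ne : ∀ u v, G.Adj u v → L u u ≠ L v v

/-- The lower bound in Hilton's theorem: a graph of even order `n` with a total colouring with `n`
colours has a complement with many edges or a large matching. -/
theorem IsRowColoring.card_le_of_even {V C : Type*} [Fintype V] [Fintype C] {H : SimpleGraph V}
    {L : V → V → C} (hL : H.IsRowColoring L) (hC : Fintype.card C = Fintype.card V)
    (hV : Even (Fintype.card V)) :
    Fintype.card V ≤ 2 * (Hᶜ.edgeSet.ncard + Hᶜ.matchingNumber) := by
  classical
  -- `D` is the union of cliques on the colour classes of vertices, so vertices missed by a maximum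
  -- matching of `D` have pairwise distinct colours.
  let D : SimpleGraph V :=
    { Adj := fun u v => u ≠ v ∧ L u u = L v v
      symm := ⟨fun u v h => ⟨h.1.symm, h.2.symm⟩⟩
      loopless := ⟨fun u h => h.1 rfl⟩ }
  have hDH : D ≤ Hᶜ := fun u v h => (compl_adj H u v).2 ⟨h.1, fun h' => hL.diag_ne u v h' h.2⟩
  obtain ⟨M, hM, hMcard⟩ := D.exists_isEdgeMatching_card_eq
  have hMle : #M ≤ Hᶜ.matchingNumber := by
    refine IsEdgeMatching.card_le_matchingNumber ⟨fun e he => ?_, hM.2⟩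
    exact edgeSet_subset_edgeSet.2 hDH (hM.1 e he)
  have hcov := card_filter_add_card_filter_not (s := univ) (fun v => ∃ e ∈ M, v ∈ e)
  rw [hM.card_filter_mem, card_univ] at hcov
  have hinj : ∀ u v, (¬ ∃ e ∈ M, u ∈ e) → (¬ ∃ e ∈ M, v ∈ e) → L u u = L v v → u = v := by
    intro u v hu hv huv
    by_contra hne
    exact (hM.exists_mem_of_card_eq_matchingNumber hMcard (show D.Adj u v from ⟨hne, huv⟩)).elim hu hv
  -- If the colour of `u` were present at every vertex, its edges together with the edges of `M`
  -- between vertices of that colour would pair up all vertices except `u`, an odd number.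
  have hmiss : ∀ u, (¬ ∃ e ∈ M, u ∈ e) → ∃ v, L v v ≠ L u u ∧ ∀ w, H.Adj v w → L v w ≠ L u u := by
    intro u hu
    by_contra! hcon
    let K : SimpleGraph V :=
      { Adj := fun v w => (L v v = L u u ∧ s(v, w) ∈ M) ∨ (H.Adj v w ∧ L v w = L u u)
        symm := ⟨by
          rintro v w (⟨h1, h2⟩ | ⟨h1, h2⟩)
          · exact Or.inl ⟨(show D.Adj v w from hM.1 _ h2).2 ▸ h1, by rwa [Sym2.eq_swap]⟩
          · exact Or.inr ⟨h1.symm, by rwa [hL.symm v w h1] at h2⟩⟩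
        loopless := ⟨by
          rintro v (⟨h1, h2⟩ | ⟨h1, h2⟩)
          · exact D.loopless.irrefl v (hM.1 _ h2)
          · exact h1.ne rfl⟩ }
    have hKu : K.degree u = 0 := by
      rw [← not_ne_iff, ← Nat.pos_iff_ne_zero, degree_pos_iff_exists_adj]
      rintro ⟨w, h | h⟩
      · exact hu ⟨_, h.2, Sym2.mem_mk_left u w⟩
      · exact hL.ne_diag u w h.1 h.2
    have hKv : ∀ v, v ≠ u → K.degree v = 1 := by
      intro v hv
      rw [degree_eq_one_iff_existsUnique_adj]
      by_cases hc : L v v = L u u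
      · have hv' : ∃ e ∈ M, v ∈ e := by
          by_contra hv'
          exact hv (hinj v u hv' hu hc)
        obtain ⟨e, he, w, rfl⟩ := hv'
        refine ⟨w, Or.inl ⟨hc, he⟩, ?_⟩
        rintro x (⟨-, hx⟩ | ⟨hx, hx'⟩)
        · exact Sym2.congr_right.1
            (hM.2 _ hx _ he v (Sym2.mem_mk_left _ _) (Sym2.mem_mk_left _ _))
        · exact absurd (hx'.trans hc.symm) (hL.ne_diag v x hx)
      · obtain ⟨w, hw, hw'⟩ := hcon v hc
        refine ⟨w, Or.inr ⟨hw, hw'⟩, ?_⟩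
        rintro x (⟨hx, -⟩ | ⟨hx, hx'⟩)
        · exact absurd hx hc
        · exact hL.eq_of_eq v x w hx hw (hx'.trans hw'.symm)
    have h1 := K.even_card_odd_degree_vertices
    have h2 : (univ.filter fun v => Odd (K.degree v)) = univ.erase u := by
      ext v
      by_cases hv : v = u
      · simp [hv, hKu]
      · simp [hv, hKv v hv]
    rw [h2, card_erase_of_mem (mem_univ u), card_univ] at h1
    have : 0 < Fintype.card V := Fintype.card_pos_iff.2 ⟨u⟩
    rw [Nat.even_iff] at h1 hV
    omega
  have hedge : 2 * Hᶜ.edgeSet.ncard = ∑ v, Hᶜ.degree v :=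
    (sum_degrees_eq_two_mul_ncard _).symm
  -- There are as many colours as vertices, so the total number of missing colours is twice the
  -- number of edges of the complement.
  have hmisscard : ∀ v, #{c | L v v ≠ c ∧ ∀ w, H.Adj v w → L v w ≠ c} = Hᶜ.degree v := by
    intro v
    have h1 : (univ.filter fun c => L v v ≠ c ∧ ∀ w, H.Adj v w → L v w ≠ c) =
        ((insert v (H.neighborFinset v)).image (L v))ᶜ := by
      ext c
      simp only [mem_filter, mem_univ, true_and, mem_compl, mem_image, mem_insert,
        mem_neighborFinset, not_exists, not_and, forall_eq_or_imp, ne_eq]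
    rw [h1, card_compl, card_image_of_injOn, card_insert_of_notMem (by simp), degree_compl, hC,
      card_neighborFinset_eq_degree]
    · omega
    · intro x hx y hy h
      simp only [coe_insert, coe_neighborFinset, Set.mem_insert_iff, mem_neighborSet] at hx hy
      rcases hx with rfl | hx <;> rcases hy with rfl | hy
      · rfl
      · exact absurd h.symm (hL.ne_diag _ _ hy)
      · exact absurd h (hL.ne_diag _ _ hx)
      · exact hL.eq_of_eq _ _ _ hx hy h
  choose! f hf using hmiss
  have hle : #{v | ¬ ∃ e ∈ M, v ∈ e} ≤
      #((univ : Finset V).sigma fun v => univ.filter fun c => L v v ≠ c ∧ ∀ w, H.Adj v w → L v w ≠ c) := by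
    refine card_le_card_of_injOn (fun u => ⟨f u, L u u⟩) ?_ ?_
    · intro u hu
      simp only [coe_filter, mem_univ, true_and, Set.mem_ofPred_eq] at hu
      simpa using hf u hu
    · intro u hu v hv h
      simp only [coe_filter, mem_univ, true_and, Set.mem_ofPred_eq] at hu hv
      simp only [Sigma.mk.injEq, heq_eq_eq] at h
      exact hinj u v hu hv h.2
  rw [card_sigma, sum_congr rfl fun v _ => hmisscard v, ← hedge] at hle
  omega

end SimpleGraph

/-! ### Total colourings as arrays, pendant vertices, and odd order -/

namespace SimpleGraph

theorem TotalColoring.exists_isRowColoring {V C : Type*} {G : SimpleGraph V}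
    (φ : G.TotalColoring C) : ∃ L : V → V → C, G.IsRowColoring L := by
  classical
  have hd : ∀ u, (if h : G.Adj u u then φ.edgeColor ⟨s(u, u), h⟩ else φ.vertColor u) =
      φ.vertColor u := fun u => dif_neg (G.irrefl)
  refine ⟨fun u v => if h : G.Adj u v then φ.edgeColor ⟨s(u, v), h⟩ else φ.vertColor u,
    ?_, ?_, ?_, ?_⟩
  · intro u v h
    simp only [hd]
    rw [dif_pos h]
    exact (φ.vert_ne_edge (Sym2.mem_mk_left u v)).symm
  · intro u v w hv hw h
    simp only [dif_pos hv, dif_pos hw] at h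
    by_contra hne
    refine φ.edge_ne_edge ?_ ⟨u, Sym2.mem_mk_left u v, Sym2.mem_mk_left u w⟩ h
    intro heq
    exact hne (Sym2.congr_right.1 (congrArg Subtype.val heq))
  · intro u v h
    simp only [dif_pos h, dif_pos h.symm, Sym2.eq_swap (a := u) (b := v)]
  · intro u v h
    simp only [hd]
    exact φ.vert_ne_vert h

namespace IsRowColoring

variable {V C : Type*} {G : SimpleGraph V} {L : V → V → C}

theorem nonempty_totalColoring (hL : G.IsRowColoring L) : Nonempty (G.TotalColoring C) := by
  have key : ∀ e : G.edgeSet, ∀ u ∈ (e : Sym2 V), ∃ v, (e : Sym2 V) = s(u, v) ∧ G.Adj u v ∧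
      L (Quot.out (e : Sym2 V)).1 (Quot.out (e : Sym2 V)).2 = L u v := by
    rintro ⟨e, he⟩ u hu
    have hout : s((Quot.out e).1, (Quot.out e).2) = e := Quot.out_eq e
    obtain ⟨v, rfl⟩ := hu
    refine ⟨v, rfl, he, ?_⟩
    rcases Sym2.eq_iff.1 hout with ⟨h1, h2⟩ | ⟨h1, h2⟩
    · rw [h1, h2]
    · rw [h1, h2]
      exact (hL.symm u v he).symm
  refine ⟨⟨fun v => L v v, fun e => L (Quot.out (e : Sym2 V)).1 (Quot.out (e : Sym2 V)).2,
    hL.diag_ne, ?_, ?_⟩⟩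
  · rintro e f hef ⟨u, hue, huf⟩ h
    obtain ⟨v, he, hv, h1⟩ := key e u hue
    obtain ⟨w, hf, hw, h2⟩ := key f u huf
    rw [h1, h2] at h
    refine hef (Subtype.ext ?_)
    rw [he, hf, hL.eq_of_eq u v w hv hw h]
  · intro u e hue h
    obtain ⟨v, -, hv, h1⟩ := key e u hue
    rw [h1] at h
    exact hL.ne_diag u v hv h.symm

theorem comp {D : Type*} (hL : G.IsRowColoring L) {f : C → D} (hf : Function.Injective f) :
    G.IsRowColoring fun u v => f (L u v) :=
  ⟨fun u v h h' => hL.ne_diag u v h (hf h'), fun u v w hv hw h => hL.eq_of_eq u v w hv hw (hf h),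
    fun u v h => congrArg f (hL.symm u v h), fun u v h h' => hL.diag_ne u v h (hf h')⟩

theorem induce (hL : G.IsRowColoring L) (S : Set V) :
    (G.induce S).IsRowColoring fun u v => L u v :=
  ⟨fun u v h => hL.ne_diag u v h, fun u v w hv hw h => Subtype.ext (hL.eq_of_eq u v w hv hw h),
    fun u v h => hL.symm u v h, fun u v h => hL.diag_ne u v h⟩

end IsRowColoring

open Finset in
/-- A total colouring of the graph left by deleting pendant vertices extends to the whole graph as
soon as there are more colours than the maximum degree. -/
theorem IsRowColoring.exists_extend_pendants {V C : Type*} [Fintype V] [Fintype C]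
    (G : SimpleGraph V) [DecidableRel G.Adj] {S : Set V} {L : S → S → C}
    (hL : (G.induce S).IsRowColoring L) (hS : ∀ v ∉ S, ∃ w ∈ S, ∀ x, G.Adj v x ↔ x = w)
    (hdeg : ∀ v, G.degree v + 1 ≤ Fintype.card C) (hC : 3 ≤ Fintype.card C) :
    ∃ L' : V → V → C, G.IsRowColoring L' := by
  classical
  have : Nonempty C := Fintype.card_pos_iff.1 (by omega)
  choose! w hwS hw using hS
  obtain ⟨L₀, hL₀⟩ : ∃ L₀ : V → V → C, ∀ (u v : V) (hu : u ∈ S) (hv : v ∈ S),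
      L₀ u v = L ⟨u, hu⟩ ⟨v, hv⟩ :=
    ⟨fun u v => if h : u ∈ S ∧ v ∈ S then L ⟨u, h.1⟩ ⟨v, h.2⟩ else Classical.arbitrary C,
      fun u v hu hv => by simp [hu, hv]⟩
  have hι : ∀ u ∈ S, ∃ ι : V → C, (∀ v, v ∉ S → G.Adj u v → ι v ≠ L₀ u u ∧
      ∀ x ∈ S, G.Adj u x → ι v ≠ L₀ u x) ∧
      ∀ v v', v ∉ S → v' ∉ S → G.Adj u v → G.Adj u v' → ι v = ι v' → v = v' := by
    intro u hu
    let Q : Finset C := (insert u {v ∈ G.neighborFinset u | v ∈ S}).image (L₀ u)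
    let P : Finset V := {v ∈ G.neighborFinset u | ¬ v ∈ S}
    -- The pendant edges at `u` need fresh colours, while `Q` holds those already used at `u` and on
    -- its edges inside `S`; altogether at most `G.degree u + 1` colours.
    have hcard : #P + #Q ≤ Fintype.card C := by
      have h1 : #Q ≤ #(insert u {v ∈ G.neighborFinset u | v ∈ S}) := card_image_le
      have h2 := card_insert_le u {v ∈ G.neighborFinset u | v ∈ S}
      have h3 := card_filter_add_card_filter_not (s := G.neighborFinset u) (fun v => v ∈ S)
      have h4 := hdeg u
      rw [card_neighborFinset_eq_degree] at h3
      simp only [P]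
      omega
    obtain ⟨e⟩ : Nonempty (P ↪ (Qᶜ : Finset C)) := by
      refine Function.Embedding.nonempty_of_card_le ?_
      rw [Fintype.card_coe, Fintype.card_coe, card_compl]
      omega
    have hP : ∀ v, v ∉ S → G.Adj u v → v ∈ P := fun v hv huv => by simp [P, hv, huv]
    refine ⟨fun v => if h : v ∈ P then e ⟨v, h⟩ else Classical.arbitrary C, ?_, ?_⟩
    · intro v hv huv
      have hmem := (e ⟨v, hP v hv huv⟩).2
      rw [mem_compl] at hmem
      simp only [dif_pos (hP v hv huv)]
      refine ⟨fun h => hmem ?_, fun x hx hux h => hmem ?_⟩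
      · rw [h]
        exact mem_image_of_mem _ (mem_insert_self _ _)
      · rw [h]
        exact mem_image_of_mem _ (mem_insert_of_mem (by simp [hx, hux]))
    · intro v v' hv hv' huv huv' h
      simp only [dif_pos (hP v hv huv), dif_pos (hP v' hv' huv')] at h
      exact congrArg Subtype.val (e.injective (Subtype.ext h))
  choose! ι hι1 hι2 using hι
  -- A pendant vertex avoids only the colours of its neighbour and of its edge, so three colours
  -- suffice.
  have hκ : ∀ v, ∃ c, c ≠ L₀ (w v) (w v) ∧ c ≠ ι (w v) v := by
    intro v
    by_contra! h
    have h1 : (univ : Finset C) ⊆ {L₀ (w v) (w v), ι (w v) v} := by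
      intro c _
      by_cases hc : c = L₀ (w v) (w v)
      · simp [hc]
      · simp [h c hc]
    have h2 := card_le_card h1
    have h3 := card_le_two (a := L₀ (w v) (w v)) (b := ι (w v) v)
    rw [card_univ] at h2
    omega
  choose κ hκ1 hκ2 using hκ
  let L' : V → V → C := fun u v =>
    if u ∈ S then (if v ∈ S then L₀ u v else ι u v) else if v = u then κ u else ι (w u) u
  have hSS : ∀ u v (hu : u ∈ S) (hv : v ∈ S), L' u v = L ⟨u, hu⟩ ⟨v, hv⟩ := fun u v hu hv => by
    simp only [L', hu, hv, if_true, hL₀ u v hu hv]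
  have hSP : ∀ u v, u ∈ S → v ∉ S → L' u v = ι u v := fun u v hu hv => by simp [L', hu, hv]
  have hPP : ∀ u, u ∉ S → L' u u = κ u := fun u hu => by simp [L', hu]
  have hPS : ∀ u, u ∉ S → L' u (w u) = ι (w u) u := fun u hu => by
    have : w u ≠ u := fun h => hu (h ▸ hwS u hu)
    simp [L', hu, this]
  have hadj : ∀ u, u ∉ S → G.Adj (w u) u := fun u hu => ((hw u hu _).2 rfl).symm
  refine ⟨L', ?_, ?_, ?_, ?_⟩
  · intro u v huv
    by_cases hu : u ∈ S
    · rw [hSS u u hu hu]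
      by_cases hv : v ∈ S
      · rw [hSS u v hu hv]
        exact hL.ne_diag ⟨u, hu⟩ ⟨v, hv⟩ huv
      · rw [hSP u v hu hv, ← hL₀ u u hu hu]
        exact (hι1 u hu v hv huv).1
    · obtain rfl := (hw u hu v).1 huv
      rw [hPS u hu, hPP u hu]
      exact (hκ2 u).symm
  · intro u v x huv hux h
    by_cases hu : u ∈ S
    · by_cases hv : v ∈ S <;> by_cases hx : x ∈ S
      · rw [hSS u v hu hv, hSS u x hu hx] at h
        exact congrArg Subtype.val (hL.eq_of_eq ⟨u, hu⟩ ⟨v, hv⟩ ⟨x, hx⟩ huv hux h)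
      · rw [hSS u v hu hv, hSP u x hu hx, ← hL₀ u v hu hv] at h
        exact absurd h.symm ((hι1 u hu x hx hux).2 v hv huv)
      · rw [hSS u x hu hx, hSP u v hu hv, ← hL₀ u x hu hx] at h
        exact absurd h ((hι1 u hu v hv huv).2 x hx hux)
      · rw [hSP u v hu hv, hSP u x hu hx] at h
        exact hι2 u hu v x hv hx huv hux h
    · rw [(hw u hu v).1 huv, (hw u hu x).1 hux]
  · have hmix : ∀ u v, u ∈ S → v ∉ S → G.Adj u v → L' u v = L' v u := by
      intro u v hu hv huv
      obtain rfl := (hw v hv u).1 huv.symm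
      rw [hPS v hv, hSP _ v hu hv]
    intro u v huv
    by_cases hu : u ∈ S <;> by_cases hv : v ∈ S
    · rw [hSS u v hu hv, hSS v u hv hu]
      exact hL.symm ⟨u, hu⟩ ⟨v, hv⟩ huv
    · exact hmix u v hu hv huv
    · exact (hmix v u hv hu huv.symm).symm
    · exact absurd ((hw u hu v).1 huv ▸ hwS u hu) hv
  · have hmix : ∀ u v, u ∈ S → v ∉ S → G.Adj u v → L' u u ≠ L' v v := by
      intro u v hu hv huv
      obtain rfl := (hw v hv u).1 huv.symm
      rw [hPP v hv, hSS _ _ hu hu, ← hL₀ _ _ hu hu]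
      exact (hκ1 v).symm
    intro u v huv
    by_cases hu : u ∈ S <;> by_cases hv : v ∈ S
    · rw [hSS u u hu hu, hSS v v hv hv]
      exact hL.diag_ne ⟨u, hu⟩ ⟨v, hv⟩ huv
    · exact hmix u v hu hv huv
    · exact (hmix v u hv hu huv.symm).symm
    · exact absurd ((hw u hu v).1 huv ▸ hwS u hu) hv

/-- Every graph of order at most an odd number `N` has a total colouring with `N` colours. -/
theorem exists_isRowColoring_of_odd {V : Type*} [Fintype V] (G : SimpleGraph V) {N : ℕ}
    (hN : Odd N) (hV : Fintype.card V ≤ N) : ∃ L : V → V → Fin N, G.IsRowColoring L := by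
  have : NeZero N := ⟨hN.pos.ne'⟩
  obtain ⟨f⟩ : Nonempty (V ↪ ZMod N) :=
    Function.Embedding.nonempty_of_card_le (by rwa [ZMod.card])
  have h2 : IsUnit (2 : ZMod N) := by
    have := (ZMod.isUnit_iff_coprime 2 N).2 (Nat.coprime_two_left.2 hN)
    exact_mod_cast this
  have h : G.IsRowColoring fun u v => f u + f v := by
    refine ⟨?_, ?_, fun u v _ => add_comm _ _, ?_⟩
    · intro u v huv h
      exact huv.ne (f.injective (add_left_cancel h)).symm
    · intro u v w _ _ h
      exact f.injective (add_left_cancel h)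
    · intro u v huv h
      rw [← two_mul, ← two_mul] at h
      exact huv.ne (f.injective (h2.mul_left_cancel h))
  obtain ⟨e⟩ : Nonempty (ZMod N ≃ Fin N) := Fintype.card_eq.1 (by simp [ZMod.card])
  exact ⟨_, h.comp e.injective⟩

end SimpleGraph

/-! ### Structure of split graphs of stretch index two -/

namespace SimpleGraph

namespace IsAcyclic

variable {V : Type*} {T : SimpleGraph V} (hT : T.IsAcyclic) {a b c d e f : V}
include hT

theorem not_three_cycle (h1 : T.Adj a b) (h2 : T.Adj b c) (h3 : T.Adj c a) : False := by
  refine hT (.cons h1 (.cons h2 (.cons h3 .nil))) ?_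
  simp [Walk.cons_isCycle_iff, h1.ne, h1.ne', h2.ne, h3.ne, h3.ne']

theorem not_four_cycle (h1 : T.Adj a b) (h2 : T.Adj b c) (h3 : T.Adj c d) (h4 : T.Adj d a)
    (hac : a ≠ c) (hbd : b ≠ d) : False := by
  refine hT (.cons h1 (.cons h2 (.cons h3 (.cons h4 .nil)))) ?_
  simp [Walk.cons_isCycle_iff, h1.ne, h1.ne', h2.ne, h3.ne, h4.ne, h4.ne', hac, hac.symm, hbd]

theorem not_five_cycle (h1 : T.Adj a b) (h2 : T.Adj b c) (h3 : T.Adj c d) (h4 : T.Adj d e)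
    (h5 : T.Adj e a) (hac : a ≠ c) (had : a ≠ d) (hbd : b ≠ d) (hbe : b ≠ e) (hce : c ≠ e) :
    False := by
  refine hT (.cons h1 (.cons h2 (.cons h3 (.cons h4 (.cons h5 .nil))))) ?_
  simp [Walk.cons_isCycle_iff, h1.ne, h1.ne', h2.ne, h3.ne, h4.ne, h5.ne, h5.ne', hac, hac.symm,
    had, had.symm, hbd, hbe, hce]

theorem not_six_cycle (h1 : T.Adj a b) (h2 : T.Adj b c) (h3 : T.Adj c d) (h4 : T.Adj d e)
    (h5 : T.Adj e f) (h6 : T.Adj f a) (hac : a ≠ c) (had : a ≠ d) (hae : a ≠ e) (hbd : b ≠ d)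
    (hbe : b ≠ e) (hbf : b ≠ f) (hce : c ≠ e) (hcf : c ≠ f) (hdf : d ≠ f) : False := by
  refine hT (.cons h1 (.cons h2 (.cons h3 (.cons h4 (.cons h5 (.cons h6 .nil)))))) ?_
  simp [Walk.cons_isCycle_iff, h1.ne, h1.ne', h2.ne, h3.ne, h4.ne, h5.ne, h6.ne, h6.ne', hac,
    hac.symm, had, had.symm, hae, hae.symm, hbd, hbe, hbf, hce, hcf, hdf]

end IsAcyclic

theorem eq_or_adj_or_exists_of_dist_le_two {V : Type*} {T : SimpleGraph V} (hT : T.Connected)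
    {u v : V} (h : T.dist u v ≤ 2) : u = v ∨ T.Adj u v ∨ ∃ w, T.Adj u w ∧ T.Adj w v := by
  obtain ⟨p, hp⟩ := (hT.preconnected u v).exists_walk_length_eq_dist
  rw [← hp] at h
  match p, h with
  | .nil, _ => exact Or.inl rfl
  | .cons h1 .nil, _ => exact Or.inr (Or.inl h1)
  | .cons h1 (.cons h2 .nil), _ => exact Or.inr (Or.inr ⟨_, h1, h2⟩)
  | .cons h1 (.cons h2 (.cons h3 p)), h =>
    simp only [Walk.length_cons] at h
    omega

/-- A set of vertices of a tree with pairwise distances at most two lies in a closed star. -/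
theorem IsTree.exists_center {V : Type*} {T : SimpleGraph V} (hT : T.IsTree) {X : Set V}
    (hX : X.Nonempty)
    (h2 : ∀ x ∈ X, ∀ y ∈ X, T.dist x y ≤ 2) : ∃ c, ∀ x ∈ X, x ≠ c → T.Adj c x := by
  have hA := hT.isAcyclic
  have h : ∀ x ∈ X, ∀ y ∈ X, x ≠ y → ¬ T.Adj x y → ∃ w, T.Adj x w ∧ T.Adj w y :=
    fun x hx y hy hne hadj =>
      ((eq_or_adj_or_exists_of_dist_le_two hT.connected (h2 x hx y hy)).resolve_left hne).resolve_left
        hadj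
  by_cases hab : ∃ a ∈ X, ∃ b ∈ X, T.Adj a b
  · obtain ⟨a, ha, b, hb, hab⟩ := hab
    have hor : ∀ x ∈ X, x ≠ a → x ≠ b → T.Adj x a ∨ T.Adj x b := by
      intro x hx hxa hxb
      by_contra! hn
      obtain ⟨w, hxw, hwa⟩ := h x hx a ha hxa hn.1
      obtain ⟨w', hxw', hwb⟩ := h x hx b hb hxb hn.2
      by_cases hww : w = w'
      · subst hww
        exact hA.not_three_cycle hwa hab hwb.symm
      · refine hA.not_five_cycle hxw hwa hab hwb.symm hxw'.symm hxa hxb ?_ hww ?_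
        · rintro rfl; exact hn.2 hxw
        · rintro rfl; exact hn.1 hxw'
    by_cases hall : ∀ x ∈ X, x ≠ a → T.Adj a x
    · exact ⟨a, hall⟩
    push Not at hall
    obtain ⟨x, hx, hxa, hnax⟩ := hall
    have hxb : x ≠ b := by rintro rfl; exact hnax hab
    have hbx : T.Adj x b := (hor x hx hxa hxb).resolve_left fun h => hnax h.symm
    refine ⟨b, fun y hy hyb => ?_⟩
    by_cases hya : y = a
    · rw [hya]; exact hab.symm
    rcases hor y hy hya hyb with hya' | hyb'
    · by_contra hnby
      have hxy : y ≠ x := by rintro rfl; exact hnax hya'.symm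
      by_cases hyx : T.Adj y x
      · exact hA.not_four_cycle hya' hab hbx.symm hyx.symm hyb hxa.symm
      · obtain ⟨w, hyw, hwx⟩ := h y hy x hx hxy hyx
        refine hA.not_five_cycle hya' hab hbx.symm hwx.symm hyw.symm hyb hxy hxa.symm ?_ ?_
        · rintro rfl; exact hnax hwx
        · rintro rfl; exact hnby hyw.symm
    · exact hyb'.symm
  -- If no two points of `X` are adjacent, any two have a common neighbour outside `X`. These
  -- midpoints must all coincide, since otherwise a cycle of length four or six appears.
  · push Not at hab
    obtain ⟨a, ha⟩ := hX
    by_cases hsub : ∀ x ∈ X, x = a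
    · exact ⟨a, fun x hx hxa => absurd (hsub x hx) hxa⟩
    push Not at hsub
    obtain ⟨b, hb, hba⟩ := hsub
    obtain ⟨w, haw, hwb⟩ := h a ha b hb hba.symm (hab a ha b hb)
    refine ⟨w, fun x hx _ => ?_⟩
    by_cases hxa : x = a
    · rw [hxa]; exact haw.symm
    by_cases hxb : x = b
    · rw [hxb]; exact hwb
    obtain ⟨w', haw', hwx'⟩ := h a ha x hx (Ne.symm hxa) (hab a ha x hx)
    obtain ⟨w'', hbw'', hwx''⟩ := h b hb x hx (Ne.symm hxb) (hab b hb x hx)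
    have hout : ∀ z ∈ X, ∀ y, T.Adj z y → y ∉ X := fun z hz y hzy hy => hab z hz y hy hzy
    have hw := hout a ha w haw
    have hw' := hout a ha w' haw'
    have hw'' := hout b hb w'' hbw''
    by_cases h1 : w = w'
    · rw [h1]; exact hwx'
    by_cases h2 : w = w''
    · rw [h2]; exact hwx''
    exfalso
    by_cases h3 : w' = w''
    · subst h3
      exact hA.not_four_cycle haw hwb hbw'' haw'.symm hba.symm h1
    · exact hA.not_six_cycle haw hwb hbw'' hwx'' hwx'.symm haw'.symm hba.symm
        (fun h => hw'' (h ▸ ha)) (Ne.symm hxa) h2 (fun h => hw (h ▸ hx)) h1 (Ne.symm hxb)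
        (fun h => hw' (h ▸ hb)) (Ne.symm h3)

open Finset in
/-- A connected split graph of stretch index two has a vertex adjacent to all other non-pendant
vertices; there are at least three non-pendant vertices, and no two pendant vertices are adjacent. -/
theorem exists_center_of_stretchIndex_eq_two {V : Type*} [Fintype V] (G : SimpleGraph V)
    [DecidableRel G.Adj] (hconn : G.Connected) (hsplit : G.IsSplit) (hs : G.stretchIndex = 2) :
    ∃ c, G.degree c ≠ 1 ∧ (∀ v, v ≠ c → G.degree v ≠ 1 → G.Adj c v) ∧
      (∀ v w, G.Adj v w → G.degree v = 1 → G.degree w ≠ 1) ∧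
      3 ≤ Set.ncard {v | G.degree v ≠ 1} := by
  classical
  -- The infimum of the empty set is 0, so the value 2 is attained.
  have hne : {t : ℕ | ∃ T : SimpleGraph V, G.IsTreeSpanner T t}.Nonempty := by
    by_contra h
    rw [Set.not_nonempty_iff_eq_empty] at h
    rw [stretchIndex, h] at hs
    simp at hs
  obtain ⟨T, hTG, hT, hdist⟩ : ∃ T : SimpleGraph V, G.IsTreeSpanner T 2 := by
    have := Nat.sInf_mem hne
    rw [← stretchIndex, hs] at this
    exact this
  have hA := hT.isAcyclic
  -- Otherwise `G` is its own tree 1-spanner. The path of length two in `T` replacing `uv` gives a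
  -- triangle, which forces the clique side to have at least three vertices.
  obtain ⟨u, v, huv, hTuv⟩ : ∃ u v, G.Adj u v ∧ ¬ T.Adj u v := by
    by_contra! h
    obtain rfl : T = G := le_antisymm hTG fun u v => h u v
    have h1 : T.stretchIndex ≤ 1 := Nat.sInf_le ⟨T, le_rfl, hT, fun u v huv =>
      (dist_eq_one_iff_adj.2 huv).le⟩
    omega
  obtain ⟨w, huw, hwv⟩ : ∃ w, T.Adj u w ∧ T.Adj w v :=
    ((eq_or_adj_or_exists_of_dist_le_two hT.connected (hdist huv)).resolve_left huv.ne).resolve_left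
      hTuv
  -- With `X` of maximum size, a vertex outside `X` has a non-neighbour in `X`; in particular the
  -- centre of the star lies in `X`.
  obtain ⟨X, ⟨hXc, hXi⟩, hmax⟩ := Set.exists_max_image
    {X : Set V | G.IsClique X ∧ G.IsIndepSet Xᶜ} Set.ncard (Set.toFinite _) (by
      obtain ⟨X, Y, hXY, hX, hY⟩ := hsplit
      exact ⟨X, hX, by rwa [hXY.compl_eq]⟩)
  have hmaxX : ∀ y ∉ X, ∃ x ∈ X, ¬ G.Adj y x := by
    intro y hy
    by_contra! h
    have h1 := hmax (insert y X) ⟨hXc.insert fun b hb _ => h b hb,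
      hXi.mono (Set.compl_subset_compl.2 (Set.subset_insert y X))⟩
    rw [Set.ncard_insert_of_notMem hy] at h1
    omega
  have htri : ∀ a b c, b ∈ X → c ∈ X → G.Adj a b → G.Adj b c → G.Adj a c → 2 < X.ncard := by
    intro a b c hb hc hab hbc hac
    rw [Set.two_lt_ncard]
    by_cases ha : a ∈ X
    · exact ⟨a, ha, b, hb, c, hc, hab.ne, hac.ne, hbc.ne⟩
    · obtain ⟨x, hx, hax⟩ := hmaxX a ha
      exact ⟨x, hx, b, hb, c, hc, fun h => hax (h ▸ hab), fun h => hax (h ▸ hac), hbc.ne⟩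
  have hcover : ∀ a b, G.Adj a b → a ∈ X ∨ b ∈ X := by
    intro a b hab
    by_contra! h
    exact hXi h.1 h.2 hab.ne hab
  have hXcard : 2 < X.ncard := by
    have h1 := hTG huw
    have h2 := hTG hwv
    by_cases hu : u ∈ X
    · rcases hcover w v h2 with hw | hv
      · exact htri v u w hu hw huv.symm h1 h2.symm
      · exact htri w u v hu hv h1.symm huv h2
    · exact htri u w v ((hcover u w h1).resolve_left hu) ((hcover u v huv).resolve_left hu) h1 h2 huv
  have hXdeg : ∀ x ∈ X, G.degree x ≠ 1 := by
    intro x hx hdeg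
    obtain ⟨a, ha, b, hb, d, hd, hab, had, hbd⟩ :=
      (Set.two_lt_ncard (Set.toFinite X)).1 hXcard
    have h1 : ∀ y ∈ X, ∀ z ∈ X, y ≠ x → z ≠ x → y = z := by
      intro y hy z hz hyx hzx
      obtain ⟨t, -, ht⟩ := degree_eq_one_iff_existsUnique_adj.1 hdeg
      rw [ht y (hXc hx hy hyx.symm), ht z (hXc hx hz hzx.symm)]
    by_cases hax : a = x
    · subst hax
      exact hbd (h1 b hb d hd hab.symm had.symm)
    · by_cases hbx : b = x
      · subst hbx
        exact had (h1 a ha d hd hab hbd.symm)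
      · exact hab (h1 a ha b hb hax hbx)
  have hdistX : ∀ x ∈ X, ∀ y ∈ X, T.dist x y ≤ 2 := by
    intro x hx y hy
    by_cases hxy : x = y
    · simp [hxy]
    · exact hdist (hXc hx hy hxy)
  obtain ⟨c, hc⟩ := hT.exists_center (Set.nonempty_of_ncard_ne_zero (by omega)) hdistX
  have hcX : c ∈ X := by
    by_contra hcX
    obtain ⟨x, hx, hcx⟩ := hmaxX c hcX
    exact hcx (hTG (hc x hx fun h => hcX (h ▸ hx)))
  refine ⟨c, hXdeg c hcX, ?_, ?_, ?_⟩
  · intro y hyc hydeg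
    by_cases hyX : y ∈ X
    · exact hXc hcX hyX hyc.symm
    by_contra hcy
    have : Nontrivial V := ⟨u, v, huv.ne⟩
    have hpos := hconn.preconnected.degree_pos_of_nontrivial y
    obtain ⟨x₁, hx₁, x₂, hx₂, hne⟩ := one_lt_card.1
      (show 1 < #(G.neighborFinset y) by rw [card_neighborFinset_eq_degree]; omega)
    rw [mem_neighborFinset] at hx₁ hx₂
    -- An edge `yx` outside `T` would be replaced by a path through some `z` in `X`, giving the
    -- triangle `c`, `z`, `x` in `T`. So all edges at `y` lie in `T`, and two of them close a
    -- 4-cycle through `c`.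
    have hT1 : ∀ x, G.Adj y x → x ≠ c ∧ T.Adj c x ∧ T.Adj y x := by
      intro x hyx
      have hxc : x ≠ c := by rintro rfl; exact hcy hyx.symm
      have hcx := hc x ((hcover y x hyx).resolve_left hyX) hxc
      refine ⟨hxc, hcx, ?_⟩
      rcases eq_or_adj_or_exists_of_dist_le_two hT.connected (hdist hyx) with h | h | ⟨z, h1, h2⟩
      · exact absurd h hyx.ne
      · exact h
      · exfalso
        have hyz := hTG h1
        have hzc : z ≠ c := by rintro rfl; exact hcy hyz.symm
        exact hA.not_three_cycle (hc z ((hcover y z hyz).resolve_left hyX) hzc) h2 hcx.symm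
    obtain ⟨-, h1, h2⟩ := hT1 x₁ hx₁
    obtain ⟨-, h3, h4⟩ := hT1 x₂ hx₂
    exact hA.not_four_cycle h2 h1.symm h3 h4.symm hyc hne
  · intro v w hvw hv
    exact hXdeg w ((hcover v w hvw).resolve_left fun h => hXdeg v h hv)
  · exact hXcard.trans_le (Set.ncard_le_ncard (fun x hx => hXdeg x hx) (Set.toFinite _))

end SimpleGraph

/-! ### Type 2 and the conclusion -/

namespace SimpleGraph

theorem not_isType2_of_isRowColoring {V C : Type*} [Fintype V] [Fintype C] (G : SimpleGraph V)
    [DecidableRel G.Adj] {L : V → V → C} (hL : G.IsRowColoring L)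
    (hC : Fintype.card C ≤ G.maxDegree + 1) : ¬ G.IsType2 := by
  obtain ⟨f⟩ : Nonempty (C ↪ Fin (G.maxDegree + 1)) :=
    Function.Embedding.nonempty_of_card_le (by simpa using hC)
  have h : G.totalChromaticNumber ≤ G.maxDegree + 1 :=
    Nat.sInf_le (hL.comp f.injective).nonempty_totalColoring
  intro h2
  rw [IsType2] at h2
  omega

theorem isType2_of_forall {V : Type*} [Fintype V] (G : SimpleGraph V) [DecidableRel G.Adj]
    (h₁ : ∃ L : V → V → Fin (G.maxDegree + 2), G.IsRowColoring L)
    (h₂ : ∀ L : V → V → Fin (G.maxDegree + 1), ¬ G.IsRowColoring L) : G.IsType2 := by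
  obtain ⟨L, hL⟩ := h₁
  refine le_antisymm (Nat.sInf_le hL.nonempty_totalColoring) ?_
  refine le_csInf ⟨_, hL.nonempty_totalColoring⟩ ?_
  rintro n ⟨φ⟩
  by_contra! hn
  obtain ⟨L', hL'⟩ := φ.exists_isRowColoring
  exact h₂ _ (hL'.comp (Fin.castLE_injective (show n ≤ G.maxDegree + 1 by omega)))

theorem hiltonCondition_iff {V : Type*} [Fintype V] (G : SimpleGraph V) :
    G.HiltonCondition ↔ 2 * (Gᶜ.edgeSet.ncard + Gᶜ.matchingNumber) < Fintype.card V := by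
  rw [HiltonCondition, Nat.card_eq_fintype_card, lt_div_iff₀ two_pos, ← Nat.cast_lt (α := ℚ)]
  push_cast
  rw [mul_comm]

/-- Every non-edge has an end in the independent side, and that side is a clique of the complement.
This is the only use of splitness in the colouring part. -/
theorem IsSplit.eq_or_compl_adj {V : Type*} {G : SimpleGraph V} (hG : G.IsSplit) (S : Set V) :
    ∀ e ∈ (G.induce S)ᶜ.edgeSet, ∀ f ∈ (G.induce S)ᶜ.edgeSet,
      ∃ x ∈ e, ∃ y ∈ f, x = y ∨ (G.induce S)ᶜ.Adj x y := by
  obtain ⟨X, Y, hXY, hX, hY⟩ := hG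
  have key : ∀ e ∈ (G.induce S)ᶜ.edgeSet, ∃ x ∈ e, (x : V) ∈ Y := by
    intro e he
    induction e with | _ a b
    rw [mem_edgeSet, compl_adj] at he
    by_contra! h
    have ha := h a (Sym2.mem_mk_left a b)
    have hb := h b (Sym2.mem_mk_right a b)
    rw [← hXY.compl_eq, Set.notMem_compl_iff] at ha hb
    exact he.2 (hX ha hb fun h => he.1 (Subtype.ext h))
  intro e he f hf
  obtain ⟨x, hxe, hx⟩ := key e he
  obtain ⟨y, hyf, hy⟩ := key f hf
  refine ⟨x, hxe, y, hyf, or_iff_not_imp_left.2 fun hxy => ?_⟩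
  rw [compl_adj]
  exact ⟨hxy, fun h => hY hx hy (fun h => hxy (Subtype.ext h)) h⟩

end SimpleGraph

theorem mainTheorem2 {V : Type*} [Fintype V] (G : SimpleGraph V) [DecidableRel G.Adj]
    (hconn : G.Connected) (hsplit : G.IsSplit) (hstretch : G.stretchIndex = 2)
    (hodd : Odd G.maxDegree) :
    G.IsType2 ↔
      G.deletePendants.maxDegree = G.maxDegree ∧ G.deletePendants.HiltonCondition := by
  classical
  obtain ⟨c, hc, hcadj, hpend, hcard⟩ :=
    G.exists_center_of_stretchIndex_eq_two hconn hsplit hstretch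
  have hmem : ∀ v, v ∈ G.pendantVertsᶜ ↔ G.degree v ≠ 1 := fun v => Iff.rfl
  have hn : 3 ≤ Fintype.card ↥(G.pendantVertsᶜ) := by
    rw [← Nat.card_eq_fintype_card, Nat.card_coe_set_eq]
    exact hcard
  have hmax : G.deletePendants.maxDegree + 1 = Fintype.card ↥(G.pendantVertsᶜ) := by
    have : Nonempty ↥(G.pendantVertsᶜ) := ⟨⟨c, hc⟩⟩
    have h1 := G.deletePendants.maxDegree_lt_card_verts
    have h2 := G.deletePendants.degree_le_maxDegree ⟨c, hc⟩
    have h3 : G.deletePendants.neighborFinset ⟨c, hc⟩ = Finset.univ.erase ⟨c, hc⟩ := by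
      ext ⟨v, hv⟩
      rw [SimpleGraph.mem_neighborFinset, Finset.mem_erase]
      refine ⟨fun h => ⟨h.ne', Finset.mem_univ _⟩, fun h => ?_⟩
      exact hcadj v (fun h' => h.1 (Subtype.ext h')) hv
    have h4 : G.deletePendants.degree ⟨c, hc⟩ = Fintype.card ↥(G.pendantVertsᶜ) - 1 := by
      rw [← SimpleGraph.card_neighborFinset_eq_degree, h3,
        Finset.card_erase_of_mem (Finset.mem_univ _), Finset.card_univ]
    omega
  have hle : G.deletePendants.maxDegree ≤ G.maxDegree :=
    SimpleGraph.IsContained.maxDegree_mono ⟨(SimpleGraph.Embedding.induce _).toCopy⟩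
  have hS : ∀ v ∉ G.pendantVertsᶜ, ∃ w ∈ G.pendantVertsᶜ, ∀ x, G.Adj v x ↔ x = w := by
    intro v hv
    rw [hmem, not_not] at hv
    obtain ⟨w, hw, hw'⟩ := SimpleGraph.degree_eq_one_iff_existsUnique_adj.1 hv
    exact ⟨w, hpend v w hw hv, fun x => ⟨hw' x, fun h => h ▸ hw⟩⟩
  have hext : ∀ {K : ℕ} {L : ↥(G.pendantVertsᶜ) → ↥(G.pendantVertsᶜ) → Fin K},
      G.maxDegree + 1 ≤ K → G.deletePendants.IsRowColoring L →
      ∃ L' : V → V → Fin K, G.IsRowColoring L' := by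
    intro K L hK hL
    refine hL.exists_extend_pendants G hS (fun v => ?_) ?_
    · have := G.degree_le_maxDegree v
      rw [Fintype.card_fin]
      omega
    · rw [Fintype.card_fin]
      omega
  rw [SimpleGraph.hiltonCondition_iff]
  constructor
  · intro htype
    have heq : G.deletePendants.maxDegree = G.maxDegree := by
      by_contra hne
      -- Here $|V(H)|=\Delta(H)+1\le\Delta(G)$, so $\Delta(G)$ colours suffice for $H$; the
      -- extension to $G$ uses one more.
      obtain ⟨L, hL⟩ := G.deletePendants.exists_isRowColoring_of_odd hodd (by omega)
      obtain ⟨L', hL'⟩ := hext le_rfl (hL.comp (Fin.castLE_injective (Nat.le_succ _)))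
      exact G.not_isType2_of_isRowColoring hL' (by simp) htype
    refine ⟨heq, ?_⟩
    by_contra hHilton
    obtain ⟨q, hq⟩ := hodd
    -- With $\Delta(G)=2q+1$ the order of $H$ is $2(q+1)$. At least three non-pendant vertices give
    -- $q+1\ge 2$.
    obtain ⟨L, h1, h2, h3⟩ := SimpleGraph.exists_row_coloring_of_matchingNumber
      (G.deletePendants)ᶜ (hsplit.eq_or_compl_adj _) (m := q + 1) (by omega) (by omega) (by omega)
    have hL : G.deletePendants.IsRowColoring L := by
      refine ⟨fun u v huv h => huv.ne (h1 u h).symm, fun u v w _ _ h => h1 u h,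
        fun u v huv => h2 u v fun h => ?_, fun u v huv h => ?_⟩
      · exact ((SimpleGraph.compl_adj _ u v).1 h).2 huv
      · rcases h3 u v h with h | h
        · exact huv.ne h
        · exact ((SimpleGraph.compl_adj _ u v).1 h).2 huv
    obtain ⟨e⟩ : Nonempty (↥(G.pendantVertsᶜ) ≃ Fin (G.maxDegree + 1)) :=
      Fintype.card_eq.1 (by rw [Fintype.card_fin]; omega)
    obtain ⟨L', hL'⟩ := hext le_rfl (hL.comp e.injective)
    exact G.not_isType2_of_isRowColoring hL' (by simp) htype
  · rintro ⟨heq, hHilton⟩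
    refine G.isType2_of_forall ?_ fun L hL => ?_
    -- The number $\Delta(G)+2$ is again odd and exceeds $|V(H)|$, which gives the upper bound on
    -- $\chi''(G)$.
    · obtain ⟨L, hL⟩ := G.deletePendants.exists_isRowColoring_of_odd
        (N := G.maxDegree + 2) (by simpa [Nat.odd_add] using hodd) (by omega)
      exact hext (Nat.le_succ _) hL
    -- A colouring of $G$ with $\Delta(G)+1$ colours restricts to $H$, whose order is exactly this
    -- even number.
    · have := (hL.induce G.pendantVertsᶜ).card_le_of_even (by rw [Fintype.card_fin]; omega)
        (by rw [← hmax, heq]; exact hodd.add_one)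
      exact absurd this (not_le.2 hHilton)
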